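/- For $n,k\ge 1$ put $H_n=\sum_{j=1}^n \frac1j$, $\zeta_n(k)=\sum_{j=1}^n \frac1{j^k}$ and $L_n(k)=\sum_{j=1}^n \frac{(-1)^{j-1}}{j^k}$. A *linear sum* of weight $p+q$ is one of the convergent series $$\sum_{n\ge1}\frac{\zeta_n(p)}{n^q},\quad \sum_{n\ge1}\frac{(-1)^{n-1}\zeta_n(p)}{n^q},\quad \sum_{n\ge1}\frac{L_n(p)}{n^q},\quad \sum_{n\ge1}\frac{(-1)^{n-1}L_n(p)}{n^q}\qquad (p\ge1,\ q\ge2).$$ Give $\ln 2$ weight $1$ and $\zeta(k)$ (for $k\ge2$) weight $k$. Say that a real number is *reducible to linear sums in weight $w$* if it is a linear combination with rational coefficients of (possibly empty) products of factors $\ln 2$ and $\zeta(k)$, $k\ge2$, of total weight $w$, and of products of one such monomial of weight $u$ with a single linear sum of weight $v$, where $u+v=w$. **Theorem.** For every integer $m\ge1$, the seven quadratic sums $$\sum_{n\ge1}\frac{L_n(1)^2}{n^{2m}}(-1)^{n-1},\quad \sum_{n\ge1}\frac{H_nL_n(1)}{n^{2m}},\quad \sum_{n\ge1}\frac{H_nL_n(1)}{n^{2m}}(-1)^{n-1},\quad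 \sum_{n\ge1}\frac{H_n^2}{n^{2m}},$$ $$\sum_{n\ge1}\frac{H_n^2}{n^{2m}}(-1)^{n-1},\quad \sum_{n\ge1}\frac{L_n(1)^2}{n^{2m}},\quad \sum_{n\ge1}\frac{H_n^2}{(2n+1)^{2m}}$$ converge, and each of them is reducible to linear sums in weight $2m+2$. -/

import Mathlib

/-- The generalized harmonic number `ζ_n(k) = ∑_{j=1}^n 1 / j^k`. -/
noncomputable def genHarmonic (k n : ℕ) : ℝ :=
  ∑ j ∈ Finset.range n, 1 / ((j : ℝ) + 1) ^ k

/-- The alternating harmonic number `L_n(k) = ∑_{j=1}^n (-1)^(j-1) / j^k`. -/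
noncomputable def altHarmonic (k n : ℕ) : ℝ :=
  ∑ j ∈ Finset.range n, (-1 : ℝ) ^ j / ((j : ℝ) + 1) ^ k

/-- `ζ_n(1)` is the harmonic number `H_n`. -/
theorem genHarmonic_one (n : ℕ) : genHarmonic 1 n = (harmonic n : ℝ) := by
  simp [genHarmonic, harmonic]

/-- The zeta value `ζ(k) = ∑_{n ≥ 1} 1 / n^k` (used for `k ≥ 2`), as a real number. -/
noncomputable def zetaValue (k : ℕ) : ℝ :=
  ∑' n : ℕ, 1 / ((n : ℝ) + 1) ^ k

/-- `zetaValue` agrees with Mathlib's Riemann zeta function. -/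
theorem ofReal_zetaValue {k : ℕ} (hk : 2 ≤ k) : (zetaValue k : ℂ) = riemannZeta k := by
  have h : 1 < (k : ℂ).re := by
    rw [Complex.natCast_re]
    exact_mod_cast (by omega : 1 < k)
  rw [zeta_eq_tsum_one_div_nat_add_one_cpow h, zetaValue, Complex.ofReal_tsum]
  refine tsum_congr fun n => ?_
  rw [Complex.cpow_natCast]
  push_cast
  rfl

/-- `IsLinearSum w s`: the real number `s` is one of the four kinds of (convergent) linear
double Euler sums of weight `w = p + q`, where `p ≥ 1` and `q ≥ 2`:
`∑ ζ_n(p) / n^q`, `∑ (-1)^(n-1) ζ_n(p) / n^q`, `∑ L_n(p) / n^q`, `∑ (-1)^(n-1) L_n(p) / n^q`.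
The index `n ≥ 1` of the series is written `n + 1` with `n : ℕ`. -/
inductive IsLinearSum : ℕ → ℝ → Prop
  | harm (p q : ℕ) (hp : 1 ≤ p) (hq : 2 ≤ q) :
      IsLinearSum (p + q) (∑' n : ℕ, genHarmonic p (n + 1) / ((n : ℝ) + 1) ^ q)
  | harmAlt (p q : ℕ) (hp : 1 ≤ p) (hq : 2 ≤ q) :
      IsLinearSum (p + q) (∑' n : ℕ, (-1 : ℝ) ^ n * genHarmonic p (n + 1) / ((n : ℝ) + 1) ^ q)
  | alt (p q : ℕ) (hp : 1 ≤ p) (hq : 2 ≤ q) :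
      IsLinearSum (p + q) (∑' n : ℕ, altHarmonic p (n + 1) / ((n : ℝ) + 1) ^ q)
  | altAlt (p q : ℕ) (hp : 1 ≤ p) (hq : 2 ≤ q) :
      IsLinearSum (p + q) (∑' n : ℕ, (-1 : ℝ) ^ n * altHarmonic p (n + 1) / ((n : ℝ) + 1) ^ q)

/-- `IsZetaLogMonomial w x`: the real number `x` is a (possibly empty) product of factors
`ln 2` (of weight `1`) and `ζ(k)`, `k ≥ 2` (of weight `k`), of total weight `w`. -/
inductive IsZetaLogMonomial : ℕ → ℝ → Prop
  | one : IsZetaLogMonomial 0 1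
  | mul_log {w : ℕ} {x : ℝ} (hx : IsZetaLogMonomial w x) :
      IsZetaLogMonomial (w + 1) (x * Real.log 2)
  | mul_zeta {w : ℕ} {x : ℝ} (k : ℕ) (hk : 2 ≤ k) (hx : IsZetaLogMonomial w x) :
      IsZetaLogMonomial (w + k) (x * zetaValue k)

/-- The real numbers that are reducible to linear sums in weight `w`: the rational linear
combinations of monomials of weight `w` in `ln 2` and zeta values, and of products of such a
monomial of weight `u` with a single linear sum of weight `v`, where `u + v = w`. -/
noncomputable def reducibleToLinearSums (w : ℕ) : Submodule ℚ ℝ :=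
  Submodule.span ℚ
    ({x | IsZetaLogMonomial w x} ∪
      {x | ∃ (u v : ℕ) (a s : ℝ),
        u + v = w ∧ IsZetaLogMonomial u a ∧ IsLinearSum v s ∧ x = a * s})

/-- The series `∑_{n ≥ 1} f n` converges, and its sum is reducible to linear sums in
weight `w`. -/
def SeriesReducible (w : ℕ) (f : ℕ → ℝ) : Prop :=
  ∃ S ∈ reducibleToLinearSums w, HasSum (fun n : ℕ => f (n + 1)) S

/-! The proof is the residue calculus for Euler sums with digamma-type kernels, carried out on
rational truncations, so that no contour integral occurs. A truncated kernel is `α N + ∑ a k / (k -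
s)` over `0 < |k| ≤ N`. Four kernels are used; as `N → ∞` they become `-(ψ(1 - s) + γ)`, the
one-sided alternating sum `∑_{k ≥ 1} (-1)^k / (k - s)`, and, with the pole at `0` removed, `1/s - π
cot πs` and `1/s - π / sin πs`.

Multiply three kernels, decompose the product into partial fractions and compare the coefficients of
`s^t` at `0`, where `t = q - 1 ≥ 1`. One side is a convolution of Taylor coefficients; the other is
a sum over the poles of `tripleResidue` (`sum_kernelCoeff_eq`). Dominated convergence with majorant
a multiple of `H_n² / n²` gives the identity for the full kernels (`hasSum_tripleResidue`). The
Taylor coefficient of index `j` tends to a rational combination of monomials of weight `j + 1`, so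
the convolution has weight `t + 3 = q + 2`.

At a pole `n ≥ 1` the regular parts of the one-sided kernels are `-H_{n-1}` and `±(L_{n-1} - ln 2)`,
while those of the two-sided kernels are `1/n`. Products of two one-sided regular parts give
quadratic sums; all other terms give linear sums or monomials. Each choice of kernels is thus one
linear relation, to be solved for a quadratic sum. The cubes of the one-sided kernels yield `H²` and
alternating `L²`. The cosecant and cotangent kernels yield alternating `H²` and plain `L²`, where
even `q` makes the contributions of `n` and `-n` add. The two mixed cubic products then yield the
sums with `H L`.

The seventh sum follows from `H_{2n+1} - L_{2n+1} = H_n`: it is the part of `∑ (H_N - L_N)² / N^q`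
over odd `N`, a rational combination of the first six. -/

/-! ### Partial fractions of products of two and three kernels -/

open Finset in
/-- Multiplying three sums of simple fractions, given the partial fraction rule for `E`. -/
theorem sum_mul_sum_mul_sum_of_partialFraction {R ι : Type*} [CommRing R] [DecidableEq ι]
    (K : Finset ι) (E : ι → R) (d : ι → ι → R)
    (H : ∀ k ∈ K, ∀ l ∈ K, ∀ m ∈ K, E k * E l * E m =
      E k * d k l * d k m + E l * d l k * d l m + E m * d m k * d m l
      + (if k = l then E k ^ 2 * d k m - E k * d k m ^ 2 else 0)
      + (if k = m then E k ^ 2 * d k l - E k * d k l ^ 2 else 0)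
      + (if l = m then E l ^ 2 * d l k - E l * d l k ^ 2 else 0)
      + (if k = l then if k = m then E k ^ 3 else 0 else 0)) (a b c : ι → R) :
    (∑ k ∈ K, a k * E k) * (∑ k ∈ K, b k * E k) * (∑ k ∈ K, c k * E k) =
      ∑ k ∈ K, (E k * (a k * (∑ m ∈ K, b m * d k m) * (∑ m ∈ K, c m * d k m)
        + b k * (∑ m ∈ K, a m * d k m) * (∑ m ∈ K, c m * d k m)
        + c k * (∑ m ∈ K, a m * d k m) * (∑ m ∈ K, b m * d k m)
        - a k * b k * (∑ m ∈ K, c m * d k m ^ 2)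
        - a k * c k * (∑ m ∈ K, b m * d k m ^ 2)
        - b k * c k * (∑ m ∈ K, a m * d k m ^ 2))
      + E k ^ 2 * (a k * b k * (∑ m ∈ K, c m * d k m) + a k * c k * (∑ m ∈ K, b m * d k m)
        + b k * c k * (∑ m ∈ K, a m * d k m))
      + E k ^ 3 * (a k * b k * c k)) := by
  have h0 : (∑ k ∈ K, a k * E k) * (∑ k ∈ K, b k * E k) * (∑ k ∈ K, c k * E k) =
      ∑ k ∈ K, ∑ l ∈ K, ∑ m ∈ K, a k * b l * c m * (E k * E l * E m) := by
    rw [sum_mul_sum, sum_mul]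
    refine sum_congr rfl fun k _ => ?_
    rw [sum_mul]
    refine sum_congr rfl fun l _ => ?_
    rw [mul_sum]
    exact sum_congr rfl fun m _ => by ring
  have h1 : ∑ k ∈ K, ∑ l ∈ K, ∑ m ∈ K, a k * b l * c m * (E k * d k l * d k m) =
      ∑ k ∈ K, E k * (a k * (∑ m ∈ K, b m * d k m) * (∑ m ∈ K, c m * d k m)) := by
    refine sum_congr rfl fun k _ => ?_
    rw [mul_assoc, sum_mul_sum, mul_sum, mul_sum]
    refine sum_congr rfl fun l _ => ?_
    rw [mul_sum, mul_sum]
    exact sum_congr rfl fun m _ => by ring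
  have h2 : ∑ k ∈ K, ∑ l ∈ K, ∑ m ∈ K, a k * b l * c m * (E l * d l k * d l m) =
      ∑ k ∈ K, E k * (b k * (∑ m ∈ K, a m * d k m) * (∑ m ∈ K, c m * d k m)) := by
    rw [sum_comm]
    refine sum_congr rfl fun k _ => ?_
    rw [mul_assoc, sum_mul_sum, mul_sum, mul_sum]
    refine sum_congr rfl fun l _ => ?_
    rw [mul_sum, mul_sum]
    exact sum_congr rfl fun m _ => by ring
  have h3 : ∑ k ∈ K, ∑ l ∈ K, ∑ m ∈ K, a k * b l * c m * (E m * d m k * d m l) =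
      ∑ k ∈ K, E k * (c k * (∑ m ∈ K, a m * d k m) * (∑ m ∈ K, b m * d k m)) := by
    have : ∀ k ∈ K, ∑ l ∈ K, ∑ m ∈ K, a k * b l * c m * (E m * d m k * d m l) =
        ∑ m ∈ K, ∑ l ∈ K, a k * b l * c m * (E m * d m k * d m l) := fun k _ => sum_comm
    rw [sum_congr rfl this, sum_comm]
    refine sum_congr rfl fun k _ => ?_
    rw [mul_assoc, sum_mul_sum, mul_sum, mul_sum]
    refine sum_congr rfl fun l _ => ?_
    rw [mul_sum, mul_sum]
    exact sum_congr rfl fun m _ => by ring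
  have h4 : ∑ k ∈ K, ∑ l ∈ K, ∑ m ∈ K, a k * b l * c m *
        (if k = l then E k ^ 2 * d k m - E k * d k m ^ 2 else 0) =
      ∑ k ∈ K, (E k ^ 2 * (a k * b k * ∑ m ∈ K, c m * d k m)
        - E k * (a k * b k * ∑ m ∈ K, c m * d k m ^ 2)) := by
    refine sum_congr rfl fun k hk => ?_
    rw [sum_eq_single k (fun l _ hl => by simp [hl.symm]) (fun h => absurd hk h)]
    simp only [mul_sum, ← sum_sub_distrib, if_true]
    exact sum_congr rfl fun m _ => by ring
  have h5 : ∑ k ∈ K, ∑ l ∈ K, ∑ m ∈ K, a k * b l * c m *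
        (if k = m then E k ^ 2 * d k l - E k * d k l ^ 2 else 0) =
      ∑ k ∈ K, (E k ^ 2 * (a k * c k * ∑ m ∈ K, b m * d k m)
        - E k * (a k * c k * ∑ m ∈ K, b m * d k m ^ 2)) := by
    refine sum_congr rfl fun k hk => ?_
    rw [sum_comm, sum_eq_single k (fun l _ hl => by simp [hl.symm]) (fun h => absurd hk h)]
    simp only [mul_sum, ← sum_sub_distrib, if_true]
    exact sum_congr rfl fun m _ => by ring
  have h6 : ∑ k ∈ K, ∑ l ∈ K, ∑ m ∈ K, a k * b l * c m *
        (if l = m then E l ^ 2 * d l k - E l * d l k ^ 2 else 0) =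
      ∑ k ∈ K, (E k ^ 2 * (b k * c k * ∑ m ∈ K, a m * d k m)
        - E k * (b k * c k * ∑ m ∈ K, a m * d k m ^ 2)) := by
    rw [sum_comm]
    refine sum_congr rfl fun k hk => ?_
    rw [sum_comm, sum_eq_single k (fun l _ hl => by simp [hl.symm]) (fun h => absurd hk h)]
    simp only [mul_sum, ← sum_sub_distrib, if_true]
    exact sum_congr rfl fun m _ => by ring
  have h7 : ∑ k ∈ K, ∑ l ∈ K, ∑ m ∈ K, a k * b l * c m *
        (if k = l then if k = m then E k ^ 3 else 0 else 0) =
      ∑ k ∈ K, E k ^ 3 * (a k * b k * c k) := by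
    refine sum_congr rfl fun k hk => ?_
    rw [sum_eq_single k (fun l _ hl => by simp [hl.symm]) (fun h => absurd hk h),
      sum_eq_single k (fun l _ hl => by simp [hl.symm]) (fun h => absurd hk h)]
    simp only [if_true]
    ring
  rw [h0, sum_congr rfl fun k hk => sum_congr rfl fun l hl => sum_congr rfl fun m hm => by
    rw [H k hk l hl m hm]]
  simp only [mul_add, sum_add_distrib]
  rw [h1, h2, h3, h4, h5, h6, h7]
  simp only [← sum_add_distrib]
  exact sum_congr rfl fun k _ => by ring

open Finset in
/-- Multiplying two sums of simple fractions, given the partial fraction rule for `E`. -/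
theorem sum_mul_sum_of_partialFraction {R ι : Type*} [CommRing R] [DecidableEq ι]
    (K : Finset ι) (E : ι → R) (d : ι → ι → R)
    (H : ∀ k ∈ K, ∀ l ∈ K, E k * E l =
      E k * d k l + E l * d l k + (if k = l then E k ^ 2 else 0)) (a b : ι → R) :
    (∑ k ∈ K, a k * E k) * (∑ k ∈ K, b k * E k) =
      ∑ k ∈ K, (E k * (a k * (∑ m ∈ K, b m * d k m) + b k * (∑ m ∈ K, a m * d k m))
      + E k ^ 2 * (a k * b k)) := by
  have h0 : (∑ k ∈ K, a k * E k) * (∑ k ∈ K, b k * E k) =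
      ∑ k ∈ K, ∑ l ∈ K, a k * b l * (E k * E l) := by
    rw [sum_mul_sum]
    exact sum_congr rfl fun k _ => sum_congr rfl fun l _ => by ring
  have h1 : ∑ k ∈ K, ∑ l ∈ K, a k * b l * (E k * d k l) =
      ∑ k ∈ K, E k * (a k * (∑ m ∈ K, b m * d k m)) := by
    refine sum_congr rfl fun k _ => ?_
    rw [mul_sum, mul_sum]
    exact sum_congr rfl fun m _ => by ring
  have h2 : ∑ k ∈ K, ∑ l ∈ K, a k * b l * (E l * d l k) =
      ∑ k ∈ K, E k * (b k * (∑ m ∈ K, a m * d k m)) := by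
    rw [sum_comm]
    refine sum_congr rfl fun k _ => ?_
    rw [mul_sum, mul_sum]
    exact sum_congr rfl fun m _ => by ring
  have h3 : ∑ k ∈ K, ∑ l ∈ K, a k * b l * (if k = l then E k ^ 2 else 0) =
      ∑ k ∈ K, E k ^ 2 * (a k * b k) := by
    refine sum_congr rfl fun k hk => ?_
    rw [sum_eq_single k (fun l _ hl => by simp [hl.symm]) (fun h => absurd hk h)]
    simp only [if_true]
    ring
  rw [h0, sum_congr rfl fun k hk => sum_congr rfl fun l hl => by rw [H k hk l hl]]
  simp only [mul_add, sum_add_distrib]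
  rw [h1, h2, h3]

open Finset in
/-- The partial fraction expansion of a product of three sums of simple fractions with constant
terms. -/
theorem const_add_sum_mul_of_partialFraction {R ι : Type*} [CommRing R] [DecidableEq ι]
    (K : Finset ι) (E : ι → R) (d : ι → ι → R) (hd : ∀ k, d k k = 0)
    (H : ∀ k ∈ K, ∀ l ∈ K, k ≠ l → E k * E l = E k * d k l + E l * d l k)
    (anti : ∀ k l, d k l = - d l k)
    (cycle : ∀ k l m, k ≠ l → l ≠ m → k ≠ m →
      d k l * d m k + d l k * d m l = d m k * d m l)
    (a b c : ι → R) (α β γ : R) :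
    (α + ∑ k ∈ K, a k * E k) * (β + ∑ k ∈ K, b k * E k) * (γ + ∑ k ∈ K, c k * E k) =
      α * β * γ +
      ∑ k ∈ K, (E k * (a k * (β + ∑ m ∈ K, b m * d k m) * (γ + ∑ m ∈ K, c m * d k m)
        + b k * (α + ∑ m ∈ K, a m * d k m) * (γ + ∑ m ∈ K, c m * d k m)
        + c k * (α + ∑ m ∈ K, a m * d k m) * (β + ∑ m ∈ K, b m * d k m)
        - a k * b k * (∑ m ∈ K, c m * d k m ^ 2)
        - a k * c k * (∑ m ∈ K, b m * d k m ^ 2)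
        - b k * c k * (∑ m ∈ K, a m * d k m ^ 2))
      + E k ^ 2 * (a k * b k * (γ + ∑ m ∈ K, c m * d k m)
        + a k * c k * (β + ∑ m ∈ K, b m * d k m)
        + b k * c k * (α + ∑ m ∈ K, a m * d k m))
      + E k ^ 3 * (a k * b k * c k)) := by
  have H2 : ∀ k ∈ K, ∀ l ∈ K, E k * E l =
      E k * d k l + E l * d l k + (if k = l then E k ^ 2 else 0) := by
    intro k hk l hl
    by_cases h : k = l
    · subst h
      rw [hd, if_pos rfl]
      ring
    · rw [if_neg h, H k hk l hl h, add_zero]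
  have H3 : ∀ k ∈ K, ∀ l ∈ K, ∀ m ∈ K, E k * E l * E m =
      E k * d k l * d k m + E l * d l k * d l m + E m * d m k * d m l
      + (if k = l then E k ^ 2 * d k m - E k * d k m ^ 2 else 0)
      + (if k = m then E k ^ 2 * d k l - E k * d k l ^ 2 else 0)
      + (if l = m then E l ^ 2 * d l k - E l * d l k ^ 2 else 0)
      + (if k = l then if k = m then E k ^ 3 else 0 else 0) := by
    -- A repeated pole `k` against a simple pole `m`: applying the two-term rule twice creates the
    -- square `E k ^ 2` and, by antisymmetry of `d`, the correction `- E k * d k m ^ 2`.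
    have rep : ∀ k ∈ K, ∀ m ∈ K, k ≠ m → E k * E k * E m =
        E m * d m k * d m k + (E k ^ 2 * d k m - E k * d k m ^ 2) := by
      intro k hk m hm h
      have h1 := H k hk m hm h
      have h2 := anti m k
      linear_combination (E k + d m k) * h1 + (E k * d k m) * h2
    intro k hk l hl m hm
    by_cases hkl : k = l
    · subst hkl
      by_cases hkm : k = m
      · subst hkm
        simp only [hd, if_true]
        ring
      · simp only [hd, if_true, if_neg hkm]
        rw [rep k hk m hm hkm]
        ring
    · by_cases hkm : k = m
      · subst hkm
        simp only [hd, if_true, if_neg hkl, if_neg (Ne.symm hkl)]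
        linear_combination rep k hk l hl hkl
      · by_cases hlm : l = m
        · subst hlm
          simp only [hd, if_true, if_neg hkl]
          linear_combination rep l hl k hk (Ne.symm hkl)
        · simp only [if_neg hkl, if_neg hkm, if_neg hlm]
          -- Three distinct poles: split `E k * E l`, then split each resulting product with `E m`.
          -- The two contributions to `E m` merge by `cycle`.
          linear_combination E m * H k hk l hl hkl + d k l * H k hk m hm hkm
            + d l k * H l hl m hm hlm + E m * cycle k l m hkl hlm hkm
  have e3 := sum_mul_sum_mul_sum_of_partialFraction K E d H3 a b c
  have eab := sum_mul_sum_of_partialFraction K E d H2 a b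
  have eac := sum_mul_sum_of_partialFraction K E d H2 a c
  have ebc := sum_mul_sum_of_partialFraction K E d H2 b c
  have expand : (α + ∑ k ∈ K, a k * E k) * (β + ∑ k ∈ K, b k * E k) * (γ + ∑ k ∈ K, c k * E k) =
      α * β * γ + ((∑ k ∈ K, a k * E k) * (∑ k ∈ K, b k * E k) * (∑ k ∈ K, c k * E k)
      + γ * ((∑ k ∈ K, a k * E k) * (∑ k ∈ K, b k * E k))
      + β * ((∑ k ∈ K, a k * E k) * (∑ k ∈ K, c k * E k))
      + α * ((∑ k ∈ K, b k * E k) * (∑ k ∈ K, c k * E k))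
      + β * γ * (∑ k ∈ K, a k * E k) + α * γ * (∑ k ∈ K, b k * E k)
      + α * β * (∑ k ∈ K, c k * E k)) := by ring
  rw [expand, e3, eab, eac, ebc]
  simp only [mul_sum (s := K) (a := γ), mul_sum (s := K) (a := β), mul_sum (s := K) (a := α),
    mul_sum (s := K) (a := β * γ), mul_sum (s := K) (a := α * γ), mul_sum (s := K) (a := α * β),
    ← sum_add_distrib]
  congr 1
  exact sum_congr rfl fun k _ => by ring

/-! ### Power series at zero and the finite residue identity -/

/-- The power series of `1 / (k - s)` at `s = 0`. -/
noncomputable def simpleFraction (k : ℤ) : PowerSeries ℝ :=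
  PowerSeries.mk fun j => 1 / (k : ℝ) ^ (j + 1)

theorem sub_X_mul_simpleFraction {k : ℤ} (hk : k ≠ 0) :
    (PowerSeries.C (k : ℝ) - PowerSeries.X) * simpleFraction k = 1 := by
  have hk' : (k : ℝ) ≠ 0 := by exact_mod_cast hk
  ext j
  rw [sub_mul, map_sub, PowerSeries.coeff_C_mul]
  cases j with
  | zero =>
    rw [PowerSeries.coeff_zero_X_mul]
    simp [simpleFraction, hk']
  | succ j =>
    rw [PowerSeries.coeff_succ_X_mul]
    simp only [simpleFraction, PowerSeries.coeff_mk, PowerSeries.coeff_one, Nat.succ_ne_zero,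
      if_false]
    field_simp
    ring

/-- Multiply `(l - X) - (k - X) = l - k` by both inverses and divide by the nonzero constant `l -
k`. -/
theorem simpleFraction_mul {k l : ℤ} (hk : k ≠ 0) (hl : l ≠ 0) (hkl : k ≠ l) :
    simpleFraction k * simpleFraction l =
      simpleFraction k * PowerSeries.C (1 / ((l : ℝ) - k))
        + simpleFraction l * PowerSeries.C (1 / ((k : ℝ) - l)) := by
  have h1 := sub_X_mul_simpleFraction hk
  have h2 := sub_X_mul_simpleFraction hl
  have h3 : (l : ℝ) - k ≠ 0 := by
    rw [sub_ne_zero]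
    exact_mod_cast hkl.symm
  have h4 : (PowerSeries.C (l : ℝ) - PowerSeries.C (k : ℝ)) *
      PowerSeries.C (1 / ((l : ℝ) - k)) = 1 := by
    rw [← map_sub, ← map_mul, mul_one_div_cancel h3, map_one]
  have h5 : PowerSeries.C (1 / ((k : ℝ) - l)) = - PowerSeries.C (1 / ((l : ℝ) - k)) := by
    rw [← map_neg, ← neg_sub (l : ℝ), one_div_neg_eq_neg_one_div]
  rw [h5]
  linear_combination (-simpleFraction k * simpleFraction l) * h4
    + simpleFraction k * PowerSeries.C (1 / ((l : ℝ) - k)) * h2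
    - simpleFraction l * PowerSeries.C (1 / ((l : ℝ) - k)) * h1

/-- Since `1 / (k - s) = k⁻¹ (1 - s/k)⁻¹`, this is the negative binomial series rescaled by `1 / k`.
-/
theorem coeff_simpleFraction_pow (k : ℤ) (d t : ℕ) :
    PowerSeries.coeff t (simpleFraction k ^ (d + 1)) =
      (d + t).choose d / (k : ℝ) ^ (t + d + 1) := by
  have h : simpleFraction k = PowerSeries.C (1 / (k : ℝ)) *
      PowerSeries.rescale (1 / (k : ℝ)) (PowerSeries.mk 1) := by
    ext j
    rw [PowerSeries.coeff_C_mul, PowerSeries.coeff_rescale]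
    simp [simpleFraction, pow_succ, mul_comm]
  rw [h, mul_pow, ← map_pow, ← map_pow, PowerSeries.mk_one_pow_eq_mk_choose_add,
    PowerSeries.coeff_C_mul, PowerSeries.coeff_rescale, PowerSeries.coeff_mk]
  rw [one_div, div_eq_mul_inv, inv_pow, inv_pow, mul_comm (_ : ℝ) (_⁻¹), ← mul_assoc, ← mul_inv,
    ← pow_add, add_comm (d + 1), add_assoc]

/-- The nonzero integers of absolute value at most `N`. -/
noncomputable def punctured (N : ℕ) : Finset ℤ := (Finset.Icc (-(N : ℤ)) N).erase 0

theorem sum_punctured {M : Type*} [AddCommMonoid M] (f : ℤ → M) (N : ℕ) :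
    ∑ k ∈ punctured N, f k = ∑ j ∈ Finset.range N, (f (j + 1) + f (-(j + 1))) := by
  induction N with
  | zero => simp [punctured]
  | succ N ih =>
    have h : punctured (N + 1) =
        insert ((N : ℤ) + 1) (insert (-((N : ℤ) + 1)) (punctured N)) := by
      ext k
      simp only [punctured, Finset.mem_erase, Finset.mem_Icc, Finset.mem_insert]
      push_cast
      omega
    rw [h, Finset.sum_insert, Finset.sum_insert, ih, Finset.sum_range_succ, add_comm, add_assoc,
      add_comm, add_assoc]
    · simp only [punctured, Finset.mem_erase, Finset.mem_Icc]
      omega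
    · simp only [punctured, Finset.mem_erase, Finset.mem_Icc, Finset.mem_insert]
      omega

/-- The regular part at the integer `n` of the truncated kernel with residues `a` and constant
term `α N`. -/
noncomputable def regularPart (a : ℤ → ℝ) (α : ℕ → ℝ) (N : ℕ) (n : ℤ) : ℝ :=
  α N + ∑ k ∈ punctured N, a k * (1 / ((k : ℝ) - n))

/-- The derivative of the regular part at the integer `n` of the truncated kernel with
residues `a`. -/
noncomputable def regularDeriv (a : ℤ → ℝ) (N : ℕ) (n : ℤ) : ℝ :=
  ∑ k ∈ punctured N, a k * (1 / ((k : ℝ) - n)) ^ 2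

/-- The Taylor coefficients at `0` of the truncated kernel with residues `a` and constant
term `α N`. -/
noncomputable def kernelCoeff (a : ℤ → ℝ) (α : ℕ → ℝ) (N j : ℕ) : ℝ :=
  (if j = 0 then α N else 0) + ∑ k ∈ punctured N, a k / (k : ℝ) ^ (j + 1)

/-- The residue at `x` of a product of three kernels divided by `s ^ q`, in terms of the residues
`a`, `b`, `c`, the regular parts `a₁`, `b₁`, `c₁` and their derivatives `a₂`, `b₂`, `c₂`. -/
noncomputable def tripleResidue (q : ℕ) (x a b c a₁ b₁ c₁ a₂ b₂ c₂ : ℝ) : ℝ :=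
  (a * b₁ * c₁ + b * a₁ * c₁ + c * a₁ * b₁ - a * b * c₂ - a * c * b₂ - b * c * a₂) / x ^ q
    + q * (a * b * c₁ + a * c * b₁ + b * c * a₁) / x ^ (q + 1)
    + (q + 1).choose 2 * (a * b * c) / x ^ (q + 2)

/-- The finite substitute for the residue theorem: the coefficient of `s^t` in the product of three
truncated kernels, computed as a Cauchy product and from the partial fractions. The powers one, two
and three of `1 / (k - s)` produce the three terms of `tripleResidue`; `t ≥ 1` removes the constant
`α β γ`. -/
theorem sum_kernelCoeff_eq (a b c : ℤ → ℝ) (α β γ : ℕ → ℝ) (N t : ℕ) (ht : 1 ≤ t) :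
    ∑ p ∈ Finset.HasAntidiagonal.antidiagonal t, (∑ r ∈ Finset.HasAntidiagonal.antidiagonal p.1,
      kernelCoeff a α N r.1 * kernelCoeff b β N r.2) * kernelCoeff c γ N p.2 =
    ∑ k ∈ punctured N, tripleResidue (t + 1) k (a k) (b k) (c k)
      (regularPart a α N k) (regularPart b β N k) (regularPart c γ N k)
      (regularDeriv a N k) (regularDeriv b N k) (regularDeriv c N k) := by
  have hne : ∀ k ∈ punctured N, k ≠ 0 := fun k hk => (Finset.mem_erase.mp hk).1
  have key := const_add_sum_mul_of_partialFraction (punctured N) simpleFraction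
    (fun k m => PowerSeries.C (1 / ((m : ℝ) - k))) (by simp)
    (fun k hk l hl hkl => simpleFraction_mul (hne k hk) (hne l hl) hkl)
    (fun k l => by
      rw [← map_neg, ← neg_sub (k : ℝ), one_div_neg_eq_neg_one_div])
    (fun k l m hkl hlm hkm => by
      have h1 : (l : ℝ) - k ≠ 0 := sub_ne_zero.mpr (by exact_mod_cast hkl.symm)
      have h2 : (m : ℝ) - l ≠ 0 := sub_ne_zero.mpr (by exact_mod_cast hlm.symm)
      have h3 : (m : ℝ) - k ≠ 0 := sub_ne_zero.mpr (by exact_mod_cast hkm.symm)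
      have h1' : (k : ℝ) - l ≠ 0 := sub_ne_zero.mpr (by exact_mod_cast hkl)
      have h2' : (l : ℝ) - m ≠ 0 := sub_ne_zero.mpr (by exact_mod_cast hlm)
      have h3' : (k : ℝ) - m ≠ 0 := sub_ne_zero.mpr (by exact_mod_cast hkm)
      simp only [← map_mul, ← map_add]
      congr 1
      field_simp
      ring)
    (fun k => PowerSeries.C (a k)) (fun k => PowerSeries.C (b k)) (fun k => PowerSeries.C (c k))
    (PowerSeries.C (α N)) (PowerSeries.C (β N)) (PowerSeries.C (γ N))
  have hc : ∀ (e : ℤ → ℝ) (ε : ℕ → ℝ) (j : ℕ), PowerSeries.coeff j (PowerSeries.C (ε N) +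
      ∑ k ∈ punctured N, PowerSeries.C (e k) * simpleFraction k) = kernelCoeff e ε N j := by
    intro e ε j
    rw [map_add, map_sum, PowerSeries.coeff_C, kernelCoeff]
    congr 1
    refine Finset.sum_congr rfl fun k _ => ?_
    rw [PowerSeries.coeff_C_mul, simpleFraction, PowerSeries.coeff_mk, mul_one_div]
  have hk := congrArg (PowerSeries.coeff t) key
  rw [PowerSeries.coeff_mul] at hk
  simp only [PowerSeries.coeff_mul (_ : ℕ) (_ + _) (_ + _), hc] at hk
  rw [hk, map_add, ← map_mul, ← map_mul, PowerSeries.coeff_C, if_neg (by omega), zero_add, map_sum]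
  refine Finset.sum_congr rfl fun k _ => ?_
  simp only [← map_mul, ← map_pow, ← map_add, ← map_sub, ← map_sum]
  rw [map_add, map_add, PowerSeries.coeff_mul_C, PowerSeries.coeff_mul_C, PowerSeries.coeff_mul_C,
    coeff_simpleFraction_pow k 1, coeff_simpleFraction_pow k 2, tripleResidue]
  simp only [regularPart, regularDeriv]
  have h1 : PowerSeries.coeff t (simpleFraction k) = 1 / (k : ℝ) ^ (t + 1) := by
    rw [simpleFraction, PowerSeries.coeff_mk]
  rw [h1, Nat.choose_one_right, show 2 + t = t + 1 + 1 by ring, show t + 2 + 1 = t + 1 + 2 by ring]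
  push_cast
  ring

/-! ### Passage to the limit by dominated convergence -/

open Filter Topology in
/-- The limits of the data attached to the truncated kernels with residues `a` and constant
terms `α`, together with the bounds required for dominated convergence. -/
structure KernelLimits (a : ℤ → ℝ) (α : ℕ → ℝ) (a₁ a₂ c : ℕ → ℝ) : Prop where
  abs_le : ∀ k, |a k| ≤ 1
  regular : ∀ n : ℕ, Tendsto (fun N => regularPart a α N (n + 1)) atTop (𝓝 (a₁ n))
  regular_le : ∀ N n : ℕ, n < N → |regularPart a α N (n + 1)| ≤ 4 * genHarmonic 1 (n + 1)
  deriv : ∀ n : ℕ, Tendsto (fun N => regularDeriv a N (n + 1)) atTop (𝓝 (a₂ n))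
  deriv_le : ∀ N n : ℕ, n < N → |regularDeriv a N (n + 1)| ≤ 5
  coeff : ∀ j : ℕ, Tendsto (fun N => kernelCoeff a α N j) atTop (𝓝 (c j))

open Filter Topology in
/-- The kernel has no poles at negative integers, where its values converge. -/
structure KernelOneSided (a : ℤ → ℝ) (α : ℕ → ℝ) (a₁ : ℕ → ℝ) : Prop where
  eq_zero : ∀ n : ℕ, a (-(n + 1)) = 0
  value : ∀ n : ℕ, Tendsto (fun N => regularPart a α N (-(n + 1))) atTop (𝓝 (a₁ n))
  value_le : ∀ N n : ℕ, n < N → |regularPart a α N (-(n + 1))| ≤ 4 * genHarmonic 1 (n + 1)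

theorem genHarmonic_succ (k n : ℕ) :
    genHarmonic k (n + 1) = genHarmonic k n + 1 / ((n : ℝ) + 1) ^ k := by
  rw [genHarmonic, Finset.sum_range_succ, genHarmonic]

theorem altHarmonic_succ (k n : ℕ) :
    altHarmonic k (n + 1) = altHarmonic k n + (-1) ^ n / ((n : ℝ) + 1) ^ k := by
  rw [altHarmonic, Finset.sum_range_succ, altHarmonic]

theorem genHarmonic_nonneg (k n : ℕ) : 0 ≤ genHarmonic k n :=
  Finset.sum_nonneg fun j _ => by positivity

theorem genHarmonic_mono (k : ℕ) : Monotone (genHarmonic k) :=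
  monotone_nat_of_le_succ fun n => by
    rw [genHarmonic_succ]
    have : 0 ≤ 1 / ((n : ℝ) + 1) ^ k := by positivity
    linarith

theorem one_le_genHarmonic (k n : ℕ) : 1 ≤ genHarmonic k (n + 1) :=
  calc (1 : ℝ) = genHarmonic k 1 := by simp [genHarmonic]
    _ ≤ _ := genHarmonic_mono k (by omega)

theorem genHarmonic_one_le (n : ℕ) : genHarmonic 1 n ≤ 5 * (n : ℝ) ^ (1 / 4 : ℝ) := by
  rcases Nat.eq_zero_or_pos n with rfl | hn
  · simp [genHarmonic]
  have h1 : (1 : ℝ) ≤ n := by exact_mod_cast hn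
  have h2 := Real.log_le_rpow_div (x := (n : ℝ)) (by positivity) (ε := 1 / 4) (by norm_num)
  have h3 := harmonic_le_one_add_log n
  have h4 : (1 : ℝ) ≤ (n : ℝ) ^ (1 / 4 : ℝ) := Real.one_le_rpow h1 (by norm_num)
  rw [genHarmonic_one]
  linarith

theorem summable_genHarmonic_sq_div_sq :
    Summable fun n : ℕ => genHarmonic 1 (n + 1) ^ 2 / ((n : ℝ) + 1) ^ 2 := by
  -- The bound `H_n ≤ 5 n^(1/4)` gives `H_n² / n² ≤ 25 n^(-3/2)`.
  have h : Summable fun n : ℕ => 25 * (1 / ((n + 1 : ℕ) : ℝ) ^ (3 / 2 : ℝ)) :=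
    ((summable_nat_add_iff 1).mpr
      (Real.summable_one_div_nat_rpow.mpr (by norm_num : (1 : ℝ) < 3 / 2))).mul_left 25
  refine Summable.of_nonneg_of_le (fun n => by positivity) (fun n => ?_) h
  have hx : (0 : ℝ) < ((n + 1 : ℕ) : ℝ) := by positivity
  have h1 := pow_le_pow_left₀ (genHarmonic_nonneg 1 (n + 1)) (genHarmonic_one_le (n + 1)) 2
  have h2 : (((n + 1 : ℕ) : ℝ) ^ (1 / 4 : ℝ)) ^ 2 * ((n + 1 : ℕ) : ℝ) ^ (3 / 2 : ℝ)
      = ((n + 1 : ℕ) : ℝ) ^ 2 := by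
    rw [← Real.rpow_natCast, ← Real.rpow_natCast, ← Real.rpow_mul hx.le, ← Real.rpow_add hx]
    norm_num
  have h3 : (0 : ℝ) < ((n + 1 : ℕ) : ℝ) ^ (3 / 2 : ℝ) := by positivity
  rw [mul_one_div, show (n : ℝ) + 1 = ((n + 1 : ℕ) : ℝ) by push_cast; ring,
    div_le_div_iff₀ (by positivity) h3, ← h2]
  nlinarith

theorem abs_tripleResidue_le {q : ℕ} (hq : 2 ≤ q) {x h a b c a₁ b₁ c₁ a₂ b₂ c₂ : ℝ}
    (hx : 1 ≤ x) (hh : 1 ≤ h) (ha : |a| ≤ 1) (hb : |b| ≤ 1) (hc : |c| ≤ 1)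
    (ha₁ : |a₁| ≤ 4 * h) (hb₁ : |b₁| ≤ 4 * h) (hc₁ : |c₁| ≤ 4 * h)
    (ha₂ : |a₂| ≤ 5) (hb₂ : |b₂| ≤ 5) (hc₂ : |c₂| ≤ 5) :
    |tripleResidue q x a b c a₁ b₁ c₁ a₂ b₂ c₂| ≤
      (63 + 12 * q + (q + 1).choose 2) * (h ^ 2 / x ^ 2) := by
  have m2 : ∀ {y z s t : ℝ}, |y| ≤ s → |z| ≤ t → |y * z| ≤ s * t := fun {y z s t} h1 h2 => by
    rw [abs_mul]
    exact mul_le_mul h1 h2 (abs_nonneg _) ((abs_nonneg _).trans h1)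
  have hd : ∀ {y s : ℝ} (p : ℕ), 2 ≤ p → |y| ≤ s → |y / x ^ p| ≤ s / x ^ 2 := fun {y s} p hp h1 => by
    rw [abs_div, abs_of_nonneg (by positivity : 0 ≤ x ^ p)]
    have h2 : x ^ 2 ≤ x ^ p := pow_le_pow_right₀ hx hp
    have := (abs_nonneg y).trans h1
    gcongr
  have hh2 : h ≤ h ^ 2 := by nlinarith
  -- Three products bounded by `4h · 4h` and three bounded by `5 ≤ 5 h²`: `48 + 15 = 63`.
  have t1 : |a * b₁ * c₁ + b * a₁ * c₁ + c * a₁ * b₁ - a * b * c₂ - a * c * b₂ - b * c * a₂|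
      ≤ 63 * h ^ 2 := by
    have e1 := abs_le.mp (m2 (m2 ha hb₁) hc₁)
    have e2 := abs_le.mp (m2 (m2 hb ha₁) hc₁)
    have e3 := abs_le.mp (m2 (m2 hc ha₁) hb₁)
    have e4 := abs_le.mp (m2 (m2 ha hb) hc₂)
    have e5 := abs_le.mp (m2 (m2 ha hc) hb₂)
    have e6 := abs_le.mp (m2 (m2 hb hc) ha₂)
    rw [abs_le]
    constructor <;> nlinarith
  have t2 : |(q : ℝ) * (a * b * c₁ + a * c * b₁ + b * c * a₁)| ≤ 12 * q * h ^ 2 := by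
    have e1 := abs_le.mp (m2 (m2 ha hb) hc₁)
    have e2 := abs_le.mp (m2 (m2 ha hc) hb₁)
    have e3 := abs_le.mp (m2 (m2 hb hc) ha₁)
    have e4 : |a * b * c₁ + a * c * b₁ + b * c * a₁| ≤ 12 * h ^ 2 := by
      rw [abs_le]
      constructor <;> linarith
    rw [abs_mul, Nat.abs_cast]
    calc (q : ℝ) * _ ≤ q * (12 * h ^ 2) := by gcongr
      _ = _ := by ring
  have t3 : |((q + 1).choose 2 : ℝ) * (a * b * c)| ≤ (q + 1).choose 2 * h ^ 2 := by
    rw [abs_mul, Nat.abs_cast]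
    have := m2 (m2 ha hb) hc
    gcongr
    linarith
  rw [tripleResidue]
  refine (abs_add_three _ _ _).trans ?_
  have := hd q hq t1
  have := hd (q + 1) (by omega) t2
  have := hd (q + 2) (by omega) t3
  calc _ ≤ _ := add_le_add_three ‹_› ‹_› ‹_›
    _ = _ := by ring

open Filter Topology in
/-- The residues of a product of three kernels divided by `s ^ q` sum to zero. -/
theorem hasSum_tripleResidue {a b c : ℤ → ℝ} {α β γ a₁ b₁ c₁ a₂ b₂ c₂ a₀ b₀ c₀ a' b' : ℕ → ℝ}
    (ha : KernelLimits a α a₁ a₂ a₀) (hb : KernelLimits b β b₁ b₂ b₀)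
    (hc : KernelLimits c γ c₁ c₂ c₀) (ha' : KernelOneSided a α a') (hb' : KernelOneSided b β b')
    {t : ℕ} (ht : 1 ≤ t) :
    HasSum (fun n : ℕ => tripleResidue (t + 1) ((n : ℝ) + 1) (a (n + 1)) (b (n + 1)) (c (n + 1))
        (a₁ n) (b₁ n) (c₁ n) (a₂ n) (b₂ n) (c₂ n)
        + c (-(n + 1)) * a' n * b' n / (-((n : ℝ) + 1)) ^ (t + 1))
      (∑ p ∈ Finset.HasAntidiagonal.antidiagonal t,
        (∑ r ∈ Finset.HasAntidiagonal.antidiagonal p.1, a₀ r.1 * b₀ r.2) * c₀ p.2) := by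
  set g : ℕ → ℝ := fun n => tripleResidue (t + 1) ((n : ℝ) + 1) (a (n + 1)) (b (n + 1)) (c (n + 1))
        (a₁ n) (b₁ n) (c₁ n) (a₂ n) (b₂ n) (c₂ n)
        + c (-(n + 1)) * a' n * b' n / (-((n : ℝ) + 1)) ^ (t + 1) with hg
  -- Extension by zero turns the finite sums into series over one index set; the bounds on regular
  -- parts and derivatives are available only for `n < N`. Index `n` collects the poles `n + 1` and
  -- `-(n + 1)`.
  let F : ℕ → ℕ → ℝ := fun N n => if n < N then
      tripleResidue (t + 1) ((n : ℝ) + 1) (a (n + 1)) (b (n + 1)) (c (n + 1))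
        (regularPart a α N (n + 1)) (regularPart b β N (n + 1)) (regularPart c γ N (n + 1))
        (regularDeriv a N (n + 1)) (regularDeriv b N (n + 1)) (regularDeriv c N (n + 1))
        + c (-(n + 1)) * regularPart a α N (-(n + 1)) * regularPart b β N (-(n + 1))
          / (-((n : ℝ) + 1)) ^ (t + 1) else 0
  -- The summand `16` covers the pole at `-(n + 1)`, where the term is at most `1 · 4H · 4H` over
  -- the power.
  let B : ℕ → ℝ := fun n => (63 + 12 * ((t + 1 : ℕ) : ℝ) + (t + 1 + 1).choose 2 + 16) *
    (genHarmonic 1 (n + 1) ^ 2 / ((n : ℝ) + 1) ^ 2)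
  have hB : Summable B := summable_genHarmonic_sq_div_sq.mul_left _
  have hlim : ∀ n, Tendsto (fun N => F N n) atTop (𝓝 (g n)) := by
    intro n
    have h1 : Tendsto (fun N =>
        tripleResidue (t + 1) ((n : ℝ) + 1) (a (n + 1)) (b (n + 1)) (c (n + 1))
        (regularPart a α N (n + 1)) (regularPart b β N (n + 1)) (regularPart c γ N (n + 1))
        (regularDeriv a N (n + 1)) (regularDeriv b N (n + 1)) (regularDeriv c N (n + 1))
        + c (-(n + 1)) * regularPart a α N (-(n + 1)) * regularPart b β N (-(n + 1))
          / (-((n : ℝ) + 1)) ^ (t + 1)) atTop (𝓝 (g n)) := by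
      have ka := ha.regular n
      have kb := hb.regular n
      have kc := hc.regular n
      have la := ha.deriv n
      have lb := hb.deriv n
      have lc := hc.deriv n
      refine Tendsto.add ?_ ((((ha'.value n).const_mul _).mul (hb'.value n)).div_const _)
      unfold tripleResidue
      refine Tendsto.add (Tendsto.add ?_ ?_) tendsto_const_nhds
      · exact ((((((((kb.const_mul _).mul kc).add ((ka.const_mul _).mul kc)).add
          ((ka.const_mul _).mul kb))).sub (lc.const_mul _)).sub (lb.const_mul _)).sub
          (la.const_mul _)).div_const _
      · exact ((((kc.const_mul _).add (kb.const_mul _)).add (ka.const_mul _)).const_mul _).div_const _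
    refine h1.congr' ?_
    filter_upwards [eventually_gt_atTop n] with N hN
    simp only [F, if_pos hN]
  have hbound : ∀ N n, ‖F N n‖ ≤ B n := by
    intro N n
    have hx : (1 : ℝ) ≤ (n : ℝ) + 1 := by
      have : (0 : ℝ) ≤ n := n.cast_nonneg
      linarith
    simp only [F]
    split_ifs with hn
    · rw [Real.norm_eq_abs]
      refine (abs_add_le _ _).trans ?_
      have h1 := abs_tripleResidue_le (by omega : 2 ≤ t + 1) hx (one_le_genHarmonic 1 n)
        (ha.abs_le (n + 1)) (hb.abs_le (n + 1)) (hc.abs_le (n + 1))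
        (ha.regular_le N n hn) (hb.regular_le N n hn) (hc.regular_le N n hn)
        (ha.deriv_le N n hn) (hb.deriv_le N n hn) (hc.deriv_le N n hn)
      have h2 : |c (-(n + 1)) * regularPart a α N (-(n + 1)) * regularPart b β N (-(n + 1))
          / (-((n : ℝ) + 1)) ^ (t + 1)| ≤
          16 * (genHarmonic 1 (n + 1) ^ 2 / ((n : ℝ) + 1) ^ 2) := by
        rw [abs_div, abs_mul, abs_mul, abs_pow, abs_neg, abs_of_pos (by linarith : (0 : ℝ) < n + 1),
          ← mul_div_assoc]
        have e1 : ((n : ℝ) + 1) ^ 2 ≤ ((n : ℝ) + 1) ^ (t + 1) := pow_le_pow_right₀ hx (by omega)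
        have e2 := mul_le_mul (mul_le_mul (hc.abs_le (-(n + 1))) (ha'.value_le N n hn)
          (abs_nonneg _) zero_le_one) (hb'.value_le N n hn) (abs_nonneg _)
          (by have := genHarmonic_nonneg 1 (n + 1); positivity)
        refine div_le_div₀ (by positivity) (e2.trans (le_of_eq (by ring))) (by positivity) e1
      calc _ ≤ _ := add_le_add h1 h2
        _ = _ := by simp only [B]; ring
    · rw [norm_zero]
      positivity
  have hsg : Summable g := Summable.of_norm_bounded hB fun n =>
    le_of_tendsto' (hlim n).norm fun N => hbound N n
  have hT := tendsto_tsum_of_dominated_convergence (𝓕 := atTop) hB hlim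
    (Eventually.of_forall fun N n => hbound N n)
  have hfin : ∀ N, ∑' n, F N n = ∑ p ∈ Finset.HasAntidiagonal.antidiagonal t,
      (∑ r ∈ Finset.HasAntidiagonal.antidiagonal p.1,
      kernelCoeff a α N r.1 * kernelCoeff b β N r.2) * kernelCoeff c γ N p.2 := by
    intro N
    rw [sum_kernelCoeff_eq a b c α β γ N t ht, sum_punctured,
      tsum_eq_sum (s := Finset.range N) fun n hn => if_neg (by simpa using hn)]
    refine Finset.sum_congr rfl fun n hn => ?_
    -- At a negative pole the residues of the first two kernels vanish, so `tripleResidue` reduces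
    -- to its single term `c * a₁ * b₁`.
    simp only [if_pos (Finset.mem_range.mp hn), ha'.eq_zero, hb'.eq_zero, tripleResidue]
    push_cast
    ring
  simp only [hfin] at hT
  have hL : Tendsto (fun N => ∑ p ∈ Finset.HasAntidiagonal.antidiagonal t,
      (∑ r ∈ Finset.HasAntidiagonal.antidiagonal p.1,
      kernelCoeff a α N r.1 * kernelCoeff b β N r.2) * kernelCoeff c γ N p.2) atTop
      (𝓝 (∑ p ∈ Finset.HasAntidiagonal.antidiagonal t,
        (∑ r ∈ Finset.HasAntidiagonal.antidiagonal p.1, a₀ r.1 * b₀ r.2) * c₀ p.2)) :=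
    tendsto_finsetSum _ fun p _ => (tendsto_finsetSum _ fun r _ =>
      (ha.coeff r.1).mul (hb.coeff r.2)).mul (hc.coeff p.2)
  rw [tendsto_nhds_unique hL hT]
  exact hsg.hasSum

/-! ### Sign characters and sums recentred at an integer -/

/-- A homomorphism from the integers to `{1, -1}`. -/
structure IsSignCharacter (χ : ℤ → ℝ) : Prop where
  map_add : ∀ m n, χ (m + n) = χ m * χ n
  mul_self : ∀ m, χ m * χ m = 1

namespace IsSignCharacter

theorem map_zero {χ : ℤ → ℝ} (hχ : IsSignCharacter χ) : χ 0 = 1 := by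
  have h1 := hχ.map_add 0 0
  rw [hχ.mul_self] at h1
  simpa using h1

theorem map_neg {χ : ℤ → ℝ} (hχ : IsSignCharacter χ) (m : ℤ) : χ (-m) = χ m := by
  have h1 := hχ.map_add m (-m)
  rw [add_neg_cancel, hχ.map_zero] at h1
  have h2 := hχ.mul_self m
  have h3 : χ m ≠ 0 := fun h => by simp [h] at h2
  exact mul_left_cancel₀ h3 (by rw [h2, ← h1])

end IsSignCharacter

theorem isSignCharacter_one : IsSignCharacter fun _ => 1 := ⟨by simp, by simp⟩

theorem isSignCharacter_neg_one_zpow : IsSignCharacter fun k => (-1 : ℝ) ^ k :=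
  ⟨fun m n => zpow_add₀ (by norm_num) m n, fun m => by
    rw [← mul_zpow]
    norm_num⟩

/-- The sum `∑_{j=1}^N χ(j) / j^e`. -/
noncomputable def signSum (χ : ℤ → ℝ) (e N : ℕ) : ℝ :=
  ∑ j ∈ Finset.range N, χ (j + 1) * (1 / ((j : ℝ) + 1)) ^ e

theorem signSum_one (e N : ℕ) : signSum (fun _ => 1) e N = genHarmonic e N :=
  Finset.sum_congr rfl fun j _ => by rw [one_mul, one_div_pow]

theorem signSum_neg_one_zpow (e N : ℕ) :
    signSum (fun k => (-1 : ℝ) ^ k) e N = - altHarmonic e N := by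
  rw [signSum, altHarmonic, ← Finset.sum_neg_distrib]
  refine Finset.sum_congr rfl fun j _ => ?_
  rw [one_div_pow, mul_one_div, ← neg_div]
  congr 1
  rw [show ((j : ℤ) + 1) = ((j + 1 : ℕ) : ℤ) by push_cast; ring, zpow_natCast, pow_succ]
  ring

theorem sum_range_sub (g : ℤ → ℝ) (p r : ℕ) :
    ∑ j ∈ Finset.range (p + 1 + r), g ((j : ℤ) - p) =
      ∑ i ∈ Finset.range p, g (-((i : ℤ) + 1)) + g 0 + ∑ i ∈ Finset.range r, g ((i : ℤ) + 1) := by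
  rw [Finset.sum_range_add, ← Finset.sum_range_reflect, Finset.sum_range_succ']
  congr 1
  · congr 1
    · refine Finset.sum_congr rfl fun i hi => ?_
      congr 1
      have := Finset.mem_range.mp hi
      omega
    · congr 1
      omega
  · refine Finset.sum_congr rfl fun i _ => ?_
    congr 1
    push_cast
    ring

theorem sum_neg_eq_signSum {χ : ℤ → ℝ} (hχ : IsSignCharacter χ) {e : ℕ}
    (N : ℕ) :
    ∑ i ∈ Finset.range N, χ (-((i : ℤ) + 1)) * (1 / (((-((i : ℤ) + 1) : ℤ)) : ℝ)) ^ e =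
      (-1) ^ e * signSum χ e N := by
  rw [signSum, Finset.mul_sum]
  refine Finset.sum_congr rfl fun i _ => ?_
  rw [hχ.map_neg]
  push_cast
  rw [one_div_neg_eq_neg_one_div, neg_pow]
  ring

theorem signSum_add (χ : ℤ → ℝ) (e : ℕ) (p N : ℕ) :
    ∑ i ∈ Finset.range N, χ ((i : ℤ) + 1 + p) * (1 / ((i : ℝ) + 1 + p)) ^ e =
      signSum χ e (N + p) - signSum χ e p := by
  rw [add_comm N p, signSum, signSum, Finset.sum_range_add, add_sub_cancel_left]
  refine Finset.sum_congr rfl fun i _ => ?_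
  push_cast
  rw [show (p : ℤ) + i + 1 = i + 1 + p by ring, show (p : ℝ) + i + 1 = i + 1 + p by ring]

/-- Recentring at `p + 1` leaves `p` terms on the left, which reflect with the sign `(-1)^e`, and
`r` terms on the right. The pole itself contributes nothing, because `1 / 0 = 0` and `e ≠ 0`. -/
theorem sum_range_shift {χ : ℤ → ℝ} (hχ : IsSignCharacter χ) {e : ℕ} (he : e ≠ 0)
    (p r : ℕ) :
    ∑ j ∈ Finset.range (p + 1 + r), χ ((j : ℤ) + 1) * (1 / (((j : ℝ) + 1) - (p + 1))) ^ e =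
      χ (p + 1) * ((-1) ^ e * signSum χ e p + signSum χ e r) := by
  have h := sum_range_sub (fun i => χ i * (1 / (i : ℝ)) ^ e) p r
  simp only [Int.cast_zero, div_zero, zero_pow he, mul_zero, add_zero] at h
  rw [sum_neg_eq_signSum hχ] at h
  rw [mul_add, mul_comm (χ _), mul_comm (χ _)]
  have h1 : signSum χ e r =
      ∑ i ∈ Finset.range r, χ ((i : ℤ) + 1) * (1 / (((i : ℤ) + 1 : ℤ) : ℝ)) ^ e :=
    Finset.sum_congr rfl fun i _ => by push_cast; rfl
  rw [← add_mul, h1, ← h, Finset.sum_mul]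
  refine Finset.sum_congr rfl fun j _ => ?_
  rw [show (j : ℤ) + 1 = (j - p) + (p + 1) by ring, hχ.map_add]
  push_cast
  rw [show (j : ℝ) + 1 - (p + 1) = j - p by ring]
  ring

theorem sum_punctured_ite (χ : ℤ → ℝ) (f : ℤ → ℝ) (N : ℕ) :
    ∑ k ∈ punctured N, (if 0 < k then χ k else 0) * f k =
      ∑ j ∈ Finset.range N, χ ((j : ℤ) + 1) * f (j + 1) := by
  rw [sum_punctured]
  refine Finset.sum_congr rfl fun j _ => ?_
  rw [if_pos (by omega), if_neg (by omega), zero_mul, add_zero]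

theorem sum_oneSided {χ : ℤ → ℝ} (hχ : IsSignCharacter χ) {e : ℕ} (he : e ≠ 0)
    (p r : ℕ) :
    ∑ k ∈ punctured (p + 1 + r), (if 0 < k then χ k else 0) *
        (1 / ((k : ℝ) - (((p : ℤ) + 1 : ℤ) : ℝ))) ^ e =
      χ (p + 1) * ((-1) ^ e * signSum χ e p + signSum χ e r) := by
  rw [sum_punctured_ite χ (fun k => (1 / ((k : ℝ) - (((p : ℤ) + 1 : ℤ) : ℝ))) ^ e),
    ← sum_range_shift hχ he]
  push_cast
  rfl

theorem sum_oneSided_neg {χ : ℤ → ℝ} (hχ : IsSignCharacter χ) {e : ℕ}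
    (p N : ℕ) :
    ∑ k ∈ punctured N, (if 0 < k then χ k else 0) *
        (1 / ((k : ℝ) - ((-((p : ℤ) + 1) : ℤ) : ℝ))) ^ e =
      χ (p + 1) * (signSum χ e (N + (p + 1)) - signSum χ e (p + 1)) := by
  rw [sum_punctured_ite χ (fun k => (1 / ((k : ℝ) - ((-((p : ℤ) + 1) : ℤ) : ℝ))) ^ e),
    ← signSum_add χ, Finset.mul_sum]
  refine Finset.sum_congr rfl fun j _ => ?_
  push_cast
  rw [hχ.map_add ((j : ℤ) + 1), sub_neg_eq_add]
  linear_combination (-χ (j + 1) * (1 / ((j : ℝ) + 1 + (p + 1))) ^ e) * hχ.mul_self (p + 1)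

/-- The negative indices continue the sum seen from `p + 1` up to distance `p + 1 + r + (p + 1)`.
The punctured range omits `k = 0`, whence the subtracted last term. -/
theorem sum_twoSided {χ : ℤ → ℝ} (hχ : IsSignCharacter χ) {e : ℕ} (he : e ≠ 0)
    (p r : ℕ) :
    ∑ k ∈ punctured (p + 1 + r), χ k * (1 / ((k : ℝ) - (((p : ℤ) + 1 : ℤ) : ℝ))) ^ e =
      χ (p + 1) * (signSum χ e r + (-1) ^ e * signSum χ e (p + 1 + r + (p + 1)))
        - (-1) ^ e * (1 / ((p : ℝ) + 1)) ^ e := by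
  have h1 := signSum_add χ e (p + 1) (p + 1 + r)
  have h2 : signSum χ e (p + 1) = signSum χ e p + χ (p + 1) * (1 / ((p : ℝ) + 1)) ^ e := by
    rw [signSum, Finset.sum_range_succ, signSum]
  have h3 : ∑ j ∈ Finset.range (p + 1 + r), χ (-((j : ℤ) + 1)) *
      (1 / (((-((j : ℤ) + 1) : ℤ) : ℝ) - (((p : ℤ) + 1 : ℤ) : ℝ))) ^ e =
      χ (p + 1) * ((-1) ^ e * ∑ i ∈ Finset.range (p + 1 + r),
        χ ((i : ℤ) + 1 + (p + 1 : ℕ)) * (1 / ((i : ℝ) + 1 + (p + 1 : ℕ))) ^ e) := by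
    rw [Finset.mul_sum, Finset.mul_sum]
    refine Finset.sum_congr rfl fun i _ => ?_
    push_cast
    rw [hχ.map_neg, hχ.map_add ((i : ℤ) + 1),
      show -((i : ℝ) + 1) - (p + 1) = -(i + 1 + (p + 1)) by ring, one_div_neg_eq_neg_one_div,
      neg_pow]
    linear_combination (-χ (i + 1) * (-1) ^ e * (1 / ((i : ℝ) + 1 + (p + 1))) ^ e) *
      hχ.mul_self (p + 1)
  have h4 := sum_range_shift hχ he p r
  rw [sum_punctured, Finset.sum_add_distrib, h3, h1, h2]
  push_cast
  rw [h4]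
  linear_combination (-(-1) ^ e * (1 / ((p : ℝ) + 1)) ^ e) * hχ.mul_self (p + 1)

theorem kernelCoeff_oneSided (χ : ℤ → ℝ)
    (α : ℕ → ℝ) (N j : ℕ) :
    kernelCoeff (fun k => if 0 < k then χ k else 0) α N j =
      (if j = 0 then α N else 0) + signSum χ (j + 1) N := by
  rw [kernelCoeff, signSum]
  congr 1
  simp only [div_eq_mul_one_div (ite _ _ _)]
  rw [sum_punctured_ite χ (fun k => 1 / (k : ℝ) ^ (j + 1))]
  push_cast
  simp only [one_div_pow]

theorem kernelCoeff_twoSided {χ : ℤ → ℝ} (hχ : IsSignCharacter χ)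
    (N j : ℕ) :
    kernelCoeff χ 0 N j = (1 + (-1) ^ (j + 1)) * signSum χ (j + 1) N := by
  rw [kernelCoeff, sum_punctured, Finset.sum_add_distrib, add_mul, one_mul,
    ← sum_neg_eq_signSum hχ, signSum]
  simp only [Pi.zero_apply, ite_self, zero_add, one_div_pow, mul_one_div]
  push_cast
  rfl

/-! ### Bounds and limits of harmonic and alternating harmonic numbers -/

theorem genHarmonic_one_add_le (m n : ℕ) :
    genHarmonic 1 (m + n) ≤ genHarmonic 1 m + genHarmonic 1 n := by
  rw [genHarmonic, Finset.sum_range_add, genHarmonic, genHarmonic]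
  gcongr with j
  linarith [(Nat.cast_nonneg m : (0 : ℝ) ≤ m)]

theorem genHarmonic_two_le (n : ℕ) : genHarmonic 2 n ≤ 2 := by
  -- The telescoping correction `1 / (n + 1)` makes the induction close.
  have h : ∀ n : ℕ, genHarmonic 2 (n + 1) ≤ 2 - 1 / ((n : ℝ) + 1) := by
    intro n
    induction n with
    | zero => norm_num [genHarmonic]
    | succ n ih =>
      rw [genHarmonic_succ]
      push_cast
      have hx : (0 : ℝ) < (n : ℝ) + 1 := by positivity
      have : 1 / ((n : ℝ) + 1 + 1) ^ 2 ≤ 1 / ((n : ℝ) + 1) - 1 / ((n : ℝ) + 1 + 1) := by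
        rw [div_sub_div _ _ (by positivity) (by positivity),
          div_le_div_iff₀ (by positivity) (by positivity)]
        nlinarith
      linarith
  have := h n
  have h1 := genHarmonic_mono 2 (Nat.le_succ n)
  have h2 : 0 ≤ 1 / ((n : ℝ) + 1) := by positivity
  exact h1.trans (this.trans (by linarith))

theorem abs_altHarmonic_le (k n : ℕ) : |altHarmonic k n| ≤ genHarmonic k n := by
  refine (Finset.abs_sum_le_sum_abs _ _).trans (le_of_eq (Finset.sum_congr rfl fun j _ => ?_))
  rw [abs_div, abs_pow, abs_neg, abs_one, one_pow, abs_of_nonneg (by positivity)]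

theorem genHarmonic_le_one (k n : ℕ) (hk : 1 ≤ k) : genHarmonic k n ≤ genHarmonic 1 n := by
  refine Finset.sum_le_sum fun j _ => ?_
  have h1 : (1 : ℝ) ≤ (j : ℝ) + 1 := by
    have : (0 : ℝ) ≤ j := j.cast_nonneg
    linarith
  have := pow_le_pow_right₀ h1 hk
  gcongr

theorem abs_altHarmonic_one_le (n : ℕ) : |altHarmonic 1 n| ≤ 1 := by
  -- The even partial sums leave exactly enough room for the next term `1 / (2n + 1)`, which bounds
  -- the odd ones.
  have h : ∀ n : ℕ, 0 ≤ altHarmonic 1 (2 * n) ∧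
      altHarmonic 1 (2 * n) ≤ 1 - 1 / (2 * (n : ℝ) + 1) := by
    intro n
    induction n with
    | zero => norm_num [altHarmonic]
    | succ n ih =>
      have e : altHarmonic 1 (2 * (n + 1)) =
          altHarmonic 1 (2 * n) + 1 / (2 * (n : ℝ) + 1) - 1 / (2 * (n : ℝ) + 2) := by
        have h1 : (-1 : ℝ) ^ (2 * n) = 1 := by simp
        rw [show 2 * (n + 1) = 2 * n + 1 + 1 by ring, altHarmonic_succ, altHarmonic_succ,
          pow_succ (-1) (2 * n), h1]
        push_cast
        ring
      have hx : (0 : ℝ) ≤ n := n.cast_nonneg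
      have h1 : 1 / (2 * (n : ℝ) + 2) ≤ 1 / (2 * (n : ℝ) + 1) := by
        gcongr
        norm_num
      have h2 : 1 / (2 * ((n + 1 : ℕ) : ℝ) + 1) ≤ 1 / (2 * (n : ℝ) + 2) := by
        push_cast
        exact one_div_le_one_div_of_le (by positivity) (by linarith)
      rw [e]
      constructor <;> linarith
  rw [abs_le]
  rcases Nat.even_or_odd' n with ⟨m, rfl | rfl⟩
  · have := h m
    have h2 : 0 ≤ 1 / (2 * (m : ℝ) + 1) := by positivity
    constructor <;> linarith
  · have := h m
    have h2 : 0 ≤ 1 / (2 * (m : ℝ) + 1) := by positivity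
    have h1 : (-1 : ℝ) ^ (2 * m) = 1 := by simp
    rw [altHarmonic_succ, h1, pow_one]
    push_cast
    constructor <;> linarith

/-- Changing the sign of the even-indexed terms subtracts them twice, and their sum is `2^(-k)
ζ_n(k)`. -/
theorem altHarmonic_two_mul (k n : ℕ) :
    altHarmonic k (2 * n) = genHarmonic k (2 * n) - 2 / 2 ^ k * genHarmonic k n := by
  induction n with
  | zero => simp [altHarmonic, genHarmonic]
  | succ n ih =>
    rw [show 2 * (n + 1) = 2 * n + 1 + 1 by ring, altHarmonic_succ, altHarmonic_succ,
      genHarmonic_succ k (2 * n + 1), genHarmonic_succ k (2 * n), genHarmonic_succ k n, ih, pow_succ,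
      pow_mul]
    push_cast
    rw [show 2 * (n : ℝ) + 1 + 1 = 2 * (n + 1) by ring, mul_pow]
    norm_num
    ring

open Filter Topology

theorem tendsto_genHarmonic {k : ℕ} (hk : 2 ≤ k) :
    Tendsto (genHarmonic k) atTop (𝓝 (zetaValue k)) := by
  have h : Summable fun n : ℕ => 1 / ((n : ℝ) + 1) ^ k := by
    have := (summable_nat_add_iff 1).mpr (Real.summable_one_div_nat_pow.mpr (by omega : 1 < k))
    simpa using this
  exact h.hasSum.tendsto_sum_nat

/-- The alternating zeta value `∑ (-1)^(n-1) / n^k`. -/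
noncomputable def etaValue (k : ℕ) : ℝ :=
  if k = 1 then Real.log 2 else (1 - 2 / 2 ^ k) * zetaValue k

theorem etaValue_one : etaValue 1 = Real.log 2 := if_pos rfl

theorem tendsto_genHarmonic_two_mul_sub :
    Tendsto (fun n => genHarmonic 1 (2 * n) - genHarmonic 1 n) atTop (𝓝 (Real.log 2)) := by
  have h1 := Real.tendsto_harmonic_sub_log
  have h2 := h1.comp (tendsto_id.const_mul_atTop' (by norm_num : 0 < 2))
  have h3 := (h2.sub h1).add_const (Real.log 2)
  rw [sub_self, zero_add] at h3
  refine h3.congr' ?_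
  filter_upwards [eventually_gt_atTop 0] with n hn
  have hn' : (n : ℝ) ≠ 0 := by positivity
  simp only [Function.comp_apply, id_eq, genHarmonic_one]
  push_cast
  rw [Real.log_mul (by norm_num) hn']
  ring

theorem tendsto_altHarmonic {k : ℕ} (hk : 1 ≤ k) :
    Tendsto (altHarmonic k) atTop (𝓝 (etaValue k)) := by
  have h1 : Tendsto (fun n => altHarmonic k (2 * n)) atTop (𝓝 (etaValue k)) := by
    simp only [altHarmonic_two_mul]
    by_cases h : k = 1
    · subst h
      rw [etaValue_one]
      simpa using tendsto_genHarmonic_two_mul_sub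
    · have h2 := tendsto_genHarmonic (k := k) (by omega)
      have h3 := (h2.comp (tendsto_id.const_mul_atTop' (by norm_num : 0 < 2))).sub
        (h2.const_mul (2 / 2 ^ k))
      rw [etaValue, if_neg h, sub_mul, one_mul]
      exact h3
  -- Leibniz's criterion provides some limit; the even subsequence above identifies it.
  obtain ⟨l, hl⟩ := Antitone.tendsto_alternating_series_of_tendsto_zero
    (f := fun n : ℕ => 1 / ((n : ℝ) + 1) ^ k)
    (fun m n hmn => by
      dsimp only
      gcongr)
    (by
      have := (tendsto_one_div_add_atTop_nhds_zero_nat (𝕜 := ℝ)).pow k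
      rw [zero_pow (by omega)] at this
      simpa using this)
  have hl' : Tendsto (altHarmonic k) atTop (𝓝 l) := by
    refine hl.congr fun n => Finset.sum_congr rfl fun j _ => ?_
    rw [mul_one_div]
  have h2 := hl'.comp (tendsto_id.const_mul_atTop' (by norm_num : 0 < 2))
  rwa [tendsto_nhds_unique h2 h1] at hl'

/-! ### The four kernels: regular parts, derivatives, Taylor coefficients -/

theorem neg_one_zpow_succ (n : ℕ) : (-1 : ℝ) ^ ((n : ℤ) + 1) = (-1) ^ (n + 1) := by
  exact_mod_cast zpow_natCast (-1 : ℝ) (n + 1)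

theorem tendsto_of_shift {f g : ℕ → ℝ} {l : ℝ} (n : ℕ) (h : ∀ r, f (n + 1 + r) = g r)
    (hg : Tendsto g atTop (𝓝 l)) : Tendsto f atTop (𝓝 l) := by
  rw [← tendsto_add_atTop_iff_nat (n + 1)]
  exact hg.congr fun r => by rw [add_comm r, h]

theorem tendsto_comp_add {f : ℕ → ℝ} {l : ℝ} (hf : Tendsto f atTop (𝓝 l)) (k : ℕ) :
    Tendsto (fun r => f (r + k)) atTop (𝓝 l) :=
  (tendsto_add_atTop_iff_nat k).mpr hf

/-- Residue `1` at the positive integers. -/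
noncomputable def harmWeight : ℤ → ℝ := fun k => if 0 < k then (fun _ => 1) k else 0

/-- Residue `(-1)^k` at the positive integers. -/
noncomputable def altWeight : ℤ → ℝ := fun k => if 0 < k then (fun k : ℤ => (-1 : ℝ) ^ k) k else 0

theorem regularPart_harm (p r : ℕ) :
    regularPart harmWeight (fun N => -genHarmonic 1 N) (p + 1 + r) (p + 1) =
      -genHarmonic 1 (p + 1 + r) + genHarmonic 1 r - genHarmonic 1 p := by
  have h := sum_oneSided isSignCharacter_one one_ne_zero p r
  simp only [pow_one, signSum_one] at h
  exact (congrArg (-genHarmonic 1 (p + 1 + r) + ·) h).trans (by ring)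

theorem regularPart_harm_neg (p N : ℕ) :
    regularPart harmWeight (fun N => -genHarmonic 1 N) N (-(p + 1)) =
      -genHarmonic 1 N + (genHarmonic 1 (N + (p + 1)) - genHarmonic 1 (p + 1)) := by
  have h := sum_oneSided_neg isSignCharacter_one (e := 1) p N
  simp only [pow_one, signSum_one, one_mul] at h
  exact congrArg (-genHarmonic 1 N + ·) h

theorem regularDeriv_harm (p r : ℕ) :
    regularDeriv harmWeight (p + 1 + r) (p + 1) = genHarmonic 2 p + genHarmonic 2 r := by
  have h := sum_oneSided isSignCharacter_one two_ne_zero p r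
  simp only [signSum_one] at h
  exact h.trans (by ring)

theorem regularPart_alt (p r : ℕ) :
    regularPart altWeight 0 (p + 1 + r) (p + 1) =
      (-1) ^ (p + 1) * (altHarmonic 1 p - altHarmonic 1 r) := by
  have h := sum_oneSided isSignCharacter_neg_one_zpow one_ne_zero p r
  simp only [pow_one, signSum_neg_one_zpow] at h
  exact (zero_add _).trans (h.trans (by rw [neg_one_zpow_succ]; ring))

theorem regularPart_alt_neg (p N : ℕ) :
    regularPart altWeight 0 N (-(p + 1)) =
      (-1) ^ (p + 1) * (altHarmonic 1 (p + 1) - altHarmonic 1 (N + (p + 1))) := by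
  have h := sum_oneSided_neg isSignCharacter_neg_one_zpow (e := 1) p N
  simp only [pow_one, signSum_neg_one_zpow] at h
  exact (zero_add _).trans (h.trans (by rw [neg_one_zpow_succ]; ring))

theorem regularDeriv_alt (p r : ℕ) :
    regularDeriv altWeight (p + 1 + r) (p + 1) =
      (-1) ^ (p + 1) * (-altHarmonic 2 p - altHarmonic 2 r) := by
  have h := sum_oneSided isSignCharacter_neg_one_zpow two_ne_zero p r
  simp only [signSum_neg_one_zpow] at h
  exact h.trans (by rw [neg_one_zpow_succ]; ring)

theorem regularPart_cot (p r : ℕ) :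
    regularPart (fun _ => 1) 0 (p + 1 + r) (p + 1) =
      genHarmonic 1 r - genHarmonic 1 (p + 1 + r + (p + 1)) + 1 / ((p : ℝ) + 1) := by
  have h := sum_twoSided isSignCharacter_one one_ne_zero p r
  simp only [pow_one, signSum_one] at h
  rw [regularPart, h, Pi.zero_apply]
  ring

theorem regularDeriv_cot (p r : ℕ) :
    regularDeriv (fun _ => 1) (p + 1 + r) (p + 1) =
      genHarmonic 2 r + genHarmonic 2 (p + 1 + r + (p + 1)) - 1 / ((p : ℝ) + 1) ^ 2 := by
  have h := sum_twoSided isSignCharacter_one two_ne_zero p r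
  simp only [signSum_one] at h
  rw [regularDeriv, h, ← one_div_pow]
  ring

theorem regularPart_csc (p r : ℕ) :
    regularPart (fun k => (-1 : ℝ) ^ k) 0 (p + 1 + r) (p + 1) =
      (-1) ^ (p + 1) * (altHarmonic 1 (p + 1 + r + (p + 1)) - altHarmonic 1 r)
        + 1 / ((p : ℝ) + 1) := by
  have h := sum_twoSided isSignCharacter_neg_one_zpow one_ne_zero p r
  simp only [pow_one, signSum_neg_one_zpow] at h
  rw [regularPart, h, neg_one_zpow_succ, Pi.zero_apply]
  ring

theorem regularDeriv_csc (p r : ℕ) :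
    regularDeriv (fun k => (-1 : ℝ) ^ k) (p + 1 + r) (p + 1) =
      (-1) ^ (p + 1) * (-altHarmonic 2 r - altHarmonic 2 (p + 1 + r + (p + 1)))
        - 1 / ((p : ℝ) + 1) ^ 2 := by
  have h := sum_twoSided isSignCharacter_neg_one_zpow two_ne_zero p r
  simp only [signSum_neg_one_zpow] at h
  rw [regularDeriv, h, neg_one_zpow_succ, ← one_div_pow]
  ring

theorem forall_lt_of_forall_add {P : ℕ → ℕ → Prop} (h : ∀ p r, P (p + 1 + r) p) :
    ∀ N n : ℕ, n < N → P N n := by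
  intro N n hn
  obtain ⟨r, rfl⟩ := Nat.exists_eq_add_of_le (Nat.succ_le_of_lt hn)
  exact h n r

theorem one_div_succ_nonneg (p : ℕ) : 0 ≤ 1 / ((p : ℝ) + 1) := by positivity

theorem one_div_succ_le_one (p : ℕ) : 1 / ((p : ℝ) + 1) ≤ 1 := by
  rw [div_le_one (by positivity)]
  linarith [(Nat.cast_nonneg p : (0 : ℝ) ≤ p)]

theorem abs_neg_one_pow_mul (n : ℕ) (x : ℝ) : |(-1) ^ n * x| = |x| := by
  rw [abs_mul, abs_neg_one_pow, one_mul]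

theorem abs_altHarmonic_two_le (n : ℕ) : |altHarmonic 2 n| ≤ 2 :=
  (abs_altHarmonic_le 2 n).trans (genHarmonic_two_le n)

/-- The limit kernel is `-(ψ(1 - s) + γ) = ∑ (1/(k - s) - 1/k)`. The constant `-H_N` makes it
converge and cancels the Taylor coefficient of index `0`. -/
theorem kernelLimits_harm :
    KernelLimits harmWeight (fun N => -genHarmonic 1 N) (fun n => -genHarmonic 1 n)
      (fun n => genHarmonic 2 n + zetaValue 2)
      (fun j => if j = 0 then 0 else zetaValue (j + 1)) where
  abs_le k := by
    unfold harmWeight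
    split_ifs <;> simp
  regular n := by
    refine tendsto_of_shift n (regularPart_harm n) ?_
    -- A block of fixed length `n + 1` in the tail of the harmonic series tends to zero term by
    -- term.
    have h : Tendsto (fun r => -(genHarmonic 1 (n + 1 + r) - genHarmonic 1 r)) atTop (𝓝 0) := by
      have h2 : Tendsto (fun r : ℕ => ∑ j ∈ Finset.range (n + 1), 1 / ((r : ℝ) + (j + 1)))
          atTop (𝓝 (∑ j ∈ Finset.range (n + 1), 0)) := by
        refine tendsto_finsetSum _ fun j _ => ?_
        simp only [one_div]
        exact tendsto_inv_atTop_zero.comp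
          (tendsto_atTop_add_const_right _ _ tendsto_natCast_atTop_atTop)
      rw [Finset.sum_const_zero] at h2
      have h3 := h2.neg
      rw [neg_zero] at h3
      refine h3.congr fun r => ?_
      rw [add_comm (n + 1) r, genHarmonic, Finset.sum_range_add _ r, genHarmonic,
        add_sub_cancel_left]
      congr 1
      refine Finset.sum_congr rfl fun j _ => ?_
      push_cast
      ring
    have h1 := h.sub_const (genHarmonic 1 n)
    rw [zero_sub] at h1
    exact h1.congr fun r => by ring
  regular_le := forall_lt_of_forall_add fun p r => by
    have h1 := genHarmonic_one_add_le (p + 1) r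
    have h2 := genHarmonic_mono 1 (Nat.le_add_left r (p + 1))
    have h3 := genHarmonic_nonneg 1 p
    have h4 := genHarmonic_mono 1 (Nat.le_succ p)
    rw [regularPart_harm, abs_le]
    constructor <;> linarith
  deriv n := tendsto_of_shift n (regularDeriv_harm n)
    ((tendsto_genHarmonic le_rfl).const_add _)
  deriv_le := forall_lt_of_forall_add fun p r => by
    have h1 := genHarmonic_two_le p
    have h2 := genHarmonic_two_le r
    have h3 := genHarmonic_nonneg 2 p
    have h4 := genHarmonic_nonneg 2 r
    rw [regularDeriv_harm, abs_le]
    constructor <;> linarith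
  coeff j := by
    refine Tendsto.congr (fun N => (kernelCoeff_oneSided (fun _ => 1) _ N j).symm) ?_
    simp only [signSum_one]
    by_cases hj : j = 0
    · subst hj
      simp
    · simp only [if_neg hj, zero_add]
      exact tendsto_genHarmonic (by omega)

theorem kernelOneSided_harm :
    KernelOneSided harmWeight (fun N => -genHarmonic 1 N) (fun n => -genHarmonic 1 (n + 1)) where
  eq_zero n := if_neg (by omega)
  value n := by
    have h := (kernelLimits_harm.regular n).neg.sub_const (genHarmonic 1 n + genHarmonic 1 (n + 1))
    have h' : Tendsto (fun N => -genHarmonic 1 N + (genHarmonic 1 (N + (n + 1)) -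
        genHarmonic 1 (n + 1))) atTop (𝓝 (-genHarmonic 1 (n + 1))) := by
      have h2 := tendsto_comp_add h (n + 1)
      simp only [add_comm _ (n + 1), regularPart_harm] at h2
      convert! h2 using 2
      · rw [add_comm _ (n + 1)]
        ring
      · ring
    exact h'.congr fun N => (regularPart_harm_neg n N).symm
  value_le N p _ := by
    have h1 := genHarmonic_one_add_le N (p + 1)
    have h2 := genHarmonic_mono 1 (Nat.le_add_right N (p + 1))
    have h3 := genHarmonic_nonneg 1 (p + 1)
    rw [regularPart_harm_neg, abs_le]
    constructor <;> linarith

theorem kernelLimits_alt :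
    KernelLimits altWeight 0 (fun n => (-1) ^ (n + 1) * (altHarmonic 1 n - Real.log 2))
      (fun n => (-1) ^ (n + 1) * (-altHarmonic 2 n - etaValue 2))
      (fun j => -etaValue (j + 1)) where
  abs_le k := by
    unfold altWeight
    split_ifs <;> simp
  regular n := by
    have h := tendsto_altHarmonic le_rfl
    rw [etaValue_one] at h
    exact tendsto_of_shift n (regularPart_alt n) ((h.const_sub _).const_mul _)
  regular_le := forall_lt_of_forall_add fun p r => by
    have h1 := one_le_genHarmonic 1 p
    have h2 := abs_le.mp (abs_altHarmonic_one_le p)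
    have h3 := abs_le.mp (abs_altHarmonic_one_le r)
    rw [regularPart_alt, abs_neg_one_pow_mul, abs_le]
    constructor <;> linarith
  deriv n := tendsto_of_shift n (regularDeriv_alt n)
    (((tendsto_altHarmonic one_le_two).const_sub _).const_mul _)
  deriv_le := forall_lt_of_forall_add fun p r => by
    have h2 := abs_le.mp (abs_altHarmonic_two_le p)
    have h3 := abs_le.mp (abs_altHarmonic_two_le r)
    rw [regularDeriv_alt, abs_neg_one_pow_mul, abs_le]
    constructor <;> linarith
  coeff j := by
    refine Tendsto.congr (fun N => (kernelCoeff_oneSided (fun k => (-1) ^ k) _ N j).symm) ?_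
    simp only [signSum_neg_one_zpow, Pi.zero_apply, ite_self,
      zero_add]
    exact (tendsto_altHarmonic (by omega)).neg

theorem kernelOneSided_alt :
    KernelOneSided altWeight 0
      (fun n => (-1) ^ (n + 1) * (altHarmonic 1 (n + 1) - Real.log 2)) where
  eq_zero n := if_neg (by omega)
  value n := by
    have h := tendsto_altHarmonic le_rfl
    rw [etaValue_one] at h
    exact (((tendsto_comp_add h (n + 1)).const_sub _).const_mul _).congr
      fun N => (regularPart_alt_neg n N).symm
  value_le N p _ := by
    have h1 := one_le_genHarmonic 1 p
    have h2 := abs_le.mp (abs_altHarmonic_one_le (p + 1))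
    have h3 := abs_le.mp (abs_altHarmonic_one_le (N + (p + 1)))
    rw [regularPart_alt_neg, abs_neg_one_pow_mul, abs_le]
    constructor <;> linarith

theorem tendsto_comp_add_add {f : ℕ → ℝ} {l : ℝ} (hf : Tendsto f atTop (𝓝 l)) (n : ℕ) :
    Tendsto (fun r => f (n + 1 + r + (n + 1))) atTop (𝓝 l) :=
  (tendsto_comp_add hf (n + 1 + (n + 1))).congr fun r => congrArg f (by ring)

/-- The limit kernel is `1/s - π cot πs`. At `j = 0` the factor `1 + (-1)^(j+1)` vanishes, so the
divergent harmonic sum and the meaningless `zetaValue 1` play no role. -/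
theorem kernelLimits_cot :
    KernelLimits (fun _ => 1) 0 (fun n => 1 / ((n : ℝ) + 1))
      (fun n => 2 * zetaValue 2 - 1 / ((n : ℝ) + 1) ^ 2)
      (fun j => (1 + (-1) ^ (j + 1)) * zetaValue (j + 1)) where
  abs_le k := by simp
  regular n := by
    refine tendsto_of_shift n (regularPart_cot n) ?_
    -- The difference of the digamma kernel's limits at `n + 1` and `-(n + 1)` gives this harmonic
    -- tail up to a constant.
    have key : Tendsto (fun r => genHarmonic 1 r - genHarmonic 1 (n + 1 + r + (n + 1)))
        atTop (𝓝 0) := by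
      have h3 := ((tendsto_comp_add (kernelLimits_harm.regular n) (n + 1)).sub
        (tendsto_comp_add (kernelOneSided_harm.value n) (n + 1))).add_const
          (genHarmonic 1 n - genHarmonic 1 (n + 1))
      simp only [add_comm _ (n + 1), regularPart_harm, regularPart_harm_neg] at h3
      convert! h3 using 2
      · rw [add_comm (n + 1 + _) (n + 1)]
        ring
      · ring
    simpa using key.add_const (1 / ((n : ℝ) + 1))
  regular_le := forall_lt_of_forall_add fun p r => by
    have h1 := genHarmonic_one_add_le (p + 1 + r) (p + 1)
    have h2 := genHarmonic_one_add_le (p + 1) r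
    have h3 := genHarmonic_mono 1 (show r ≤ p + 1 + r + (p + 1) by omega)
    have h4 := one_le_genHarmonic 1 p
    have h5 := one_div_succ_nonneg p
    have h6 := one_div_succ_le_one p
    rw [regularPart_cot, abs_le]
    constructor <;> linarith
  deriv n := by
    refine tendsto_of_shift n (regularDeriv_cot n) ?_
    rw [two_mul]
    exact ((tendsto_genHarmonic le_rfl).add
      (tendsto_comp_add_add (tendsto_genHarmonic le_rfl) n)).sub_const _
  deriv_le := forall_lt_of_forall_add fun p r => by
    have h1 := genHarmonic_two_le (p + 1 + r + (p + 1))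
    have h2 := genHarmonic_two_le r
    have h3 := genHarmonic_nonneg 2 (p + 1 + r + (p + 1))
    have h4 := genHarmonic_nonneg 2 r
    have h5 := one_div_succ_nonneg p
    have h6 := one_div_succ_le_one p
    rw [regularDeriv_cot, abs_le, ← one_div_pow]
    constructor <;> nlinarith
  coeff j := by
    simp only [kernelCoeff_twoSided isSignCharacter_one, signSum_one]
    by_cases hj : j = 0
    · subst hj
      simp
    · exact (tendsto_genHarmonic (by omega)).const_mul _

/-- The limit kernel is `1/s - π / sin πs`. Its derivative bound `4 + 1` uses the whole constant
`5`. -/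
theorem kernelLimits_csc :
    KernelLimits (fun k => (-1 : ℝ) ^ k) 0 (fun n => 1 / ((n : ℝ) + 1))
      (fun n => (-1) ^ (n + 1) * (-2 * etaValue 2) - 1 / ((n : ℝ) + 1) ^ 2)
      (fun j => (1 + (-1) ^ (j + 1)) * -etaValue (j + 1)) where
  abs_le k := by simp
  regular n := by
    refine tendsto_of_shift n (regularPart_csc n) ?_
    have h := (((tendsto_comp_add_add (tendsto_altHarmonic le_rfl) n).sub
      (tendsto_altHarmonic le_rfl)).const_mul ((-1) ^ (n + 1))).add_const (1 / ((n : ℝ) + 1))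
    simpa using h
  regular_le := forall_lt_of_forall_add fun p r => by
    have h2 := abs_altHarmonic_one_le (p + 1 + r + (p + 1))
    have h3 := abs_altHarmonic_one_le r
    have h4 := one_le_genHarmonic 1 p
    have h5 := one_div_succ_nonneg p
    have h6 := one_div_succ_le_one p
    rw [regularPart_csc]
    refine (abs_add_le _ _).trans ?_
    rw [abs_neg_one_pow_mul, abs_of_nonneg h5]
    have := abs_sub (altHarmonic 1 (p + 1 + r + (p + 1))) (altHarmonic 1 r)
    linarith
  deriv n := by
    refine tendsto_of_shift n (regularDeriv_csc n) ?_
    have h := (((tendsto_altHarmonic one_le_two).neg.sub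
      (tendsto_comp_add_add (tendsto_altHarmonic one_le_two) n)).const_mul
        ((-1) ^ (n + 1))).sub_const (1 / ((n : ℝ) + 1) ^ 2)
    rwa [show -etaValue 2 - etaValue 2 = -2 * etaValue 2 by ring] at h
  deriv_le := forall_lt_of_forall_add fun p r => by
    have h2 := abs_le.mp (abs_altHarmonic_two_le (p + 1 + r + (p + 1)))
    have h3 := abs_le.mp (abs_altHarmonic_two_le r)
    have h5 := one_div_succ_nonneg p
    have h6 := one_div_succ_le_one p
    have h7 : |1 / ((p : ℝ) + 1) ^ 2| ≤ 1 := by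
      rw [← one_div_pow, abs_of_nonneg (by positivity)]
      exact pow_le_one₀ h5 h6
    rw [regularDeriv_csc]
    refine (abs_sub _ _).trans ?_
    have : |(-1) ^ (p + 1) * (-altHarmonic 2 r - altHarmonic 2 (p + 1 + r + (p + 1)))| ≤ 4 := by
      rw [abs_neg_one_pow_mul, abs_le]
      constructor <;> linarith
    linarith
  coeff j := by
    simp only [kernelCoeff_twoSided isSignCharacter_neg_one_zpow, signSum_neg_one_zpow]
    exact (tendsto_altHarmonic (by omega)).neg.const_mul _

/-! ### Weights and homogeneity -/

/-- The rational span of the monomials of weight `w` in `ln 2` and zeta values. -/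
noncomputable def monomialSpan (w : ℕ) : Submodule ℚ ℝ :=
  Submodule.span ℚ {x | IsZetaLogMonomial w x}

theorem IsZetaLogMonomial.mul {u v : ℕ} {x y : ℝ} (hx : IsZetaLogMonomial u x)
    (hy : IsZetaLogMonomial v y) : IsZetaLogMonomial (u + v) (x * y) := by
  induction hy with
  | one => rwa [mul_one, add_zero]
  | mul_log _ ih =>
    rw [← add_assoc, ← mul_assoc]
    exact ih.mul_log
  | mul_zeta k hk _ ih =>
    rw [← add_assoc, ← mul_assoc]
    exact ih.mul_zeta k hk

theorem monomialSpan_le (w : ℕ) : monomialSpan w ≤ reducibleToLinearSums w :=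
  Submodule.span_mono Set.subset_union_left

theorem ratCast_mul_mem {S : Submodule ℚ ℝ} (r : ℚ) {x : ℝ} (hx : x ∈ S) : (r : ℝ) * x ∈ S := by
  rw [← Rat.smul_def]
  exact S.smul_mem r hx

theorem mul_mem_of_span {s t : Set ℝ} {S : Submodule ℚ ℝ} (h : ∀ x ∈ s, ∀ y ∈ t, x * y ∈ S)
    {x y : ℝ} (hx : x ∈ Submodule.span ℚ s) (hy : y ∈ Submodule.span ℚ t) : x * y ∈ S := by
  induction hx using Submodule.span_induction with
  | zero => simp
  | add x₁ x₂ _ _ h₁ h₂ =>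
    rw [add_mul]
    exact S.add_mem h₁ h₂
  | smul r x₁ _ h₁ =>
    rw [smul_mul_assoc]
    exact S.smul_mem r h₁
  | mem x hx =>
    induction hy using Submodule.span_induction with
    | zero => simp
    | add y₁ y₂ _ _ h₁ h₂ =>
      rw [mul_add]
      exact S.add_mem h₁ h₂
    | smul r y₁ _ h₁ =>
      rw [mul_smul_comm]
      exact S.smul_mem r h₁
    | mem y hy => exact h x hx y hy

theorem mul_mem_monomialSpan {u v w : ℕ} (h : u + v = w) {x y : ℝ} (hx : x ∈ monomialSpan u)
    (hy : y ∈ monomialSpan v) : x * y ∈ monomialSpan w := by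
  subst h
  exact mul_mem_of_span (fun _ hx _ hy => Submodule.subset_span (IsZetaLogMonomial.mul hx hy)) hx hy

theorem mul_mem_reducibleToLinearSums {u v w : ℕ} (h : u + v = w) {x y : ℝ}
    (hx : x ∈ monomialSpan u) (hy : y ∈ reducibleToLinearSums v) :
    x * y ∈ reducibleToLinearSums w := by
  subst h
  refine mul_mem_of_span (fun x hx y hy => Submodule.subset_span ?_) hx hy
  rcases hy with hy | ⟨u', v', a, s, rfl, ha, hs, rfl⟩
  · exact Or.inl (IsZetaLogMonomial.mul hx hy)
  · exact Or.inr ⟨u + u', v', x * a, s, add_assoc _ _ _, IsZetaLogMonomial.mul hx ha, hs,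
      (mul_assoc _ _ _).symm⟩

theorem zetaValue_mem {k : ℕ} (hk : 2 ≤ k) : zetaValue k ∈ monomialSpan k := by
  have h := IsZetaLogMonomial.one.mul_zeta k hk
  rw [one_mul, zero_add] at h
  exact Submodule.subset_span h

theorem log_two_mem : Real.log 2 ∈ monomialSpan 1 := by
  have h := IsZetaLogMonomial.one.mul_log
  rw [one_mul, zero_add] at h
  exact Submodule.subset_span h

theorem etaValue_mem {k : ℕ} (hk : 1 ≤ k) : etaValue k ∈ monomialSpan k := by
  rw [etaValue]
  split_ifs with h
  · subst h
    exact log_two_mem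
  · have := ratCast_mul_mem (1 - 2 / 2 ^ k) (zetaValue_mem (by omega : 2 ≤ k))
    push_cast at this
    exact this

/-- The coefficients of a kernel are homogeneous: the `j`-th one has weight `j + 1`. -/
def IsHomogeneous (c : ℕ → ℝ) : Prop := ∀ j, c j ∈ monomialSpan (j + 1)

theorem isHomogeneous_harm : IsHomogeneous fun j => if j = 0 then 0 else zetaValue (j + 1) := by
  intro j
  dsimp only
  split_ifs with h
  · exact Submodule.zero_mem _
  · exact zetaValue_mem (by omega)

theorem isHomogeneous_alt : IsHomogeneous fun j => -etaValue (j + 1) :=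
  fun j => Submodule.neg_mem _ (etaValue_mem (by omega))

theorem isHomogeneous_cot : IsHomogeneous fun j => (1 + (-1) ^ (j + 1)) * zetaValue (j + 1) := by
  intro j
  by_cases h : j = 0
  · subst h
    simp
  · have := ratCast_mul_mem (1 + (-1) ^ (j + 1)) (zetaValue_mem (by omega : 2 ≤ j + 1))
    push_cast at this
    exact this

theorem isHomogeneous_csc : IsHomogeneous fun j => (1 + (-1) ^ (j + 1)) * -etaValue (j + 1) := by
  intro j
  have := ratCast_mul_mem (1 + (-1) ^ (j + 1)) (isHomogeneous_alt j)
  push_cast at this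
  exact this

/-- Three indices with sum `t` have weights one larger each, in total `t + 3`. -/
theorem IsHomogeneous.sum_mem {a b c : ℕ → ℝ} (ha : IsHomogeneous a) (hb : IsHomogeneous b)
    (hc : IsHomogeneous c) (t : ℕ) :
    ∑ p ∈ Finset.HasAntidiagonal.antidiagonal t,
      (∑ r ∈ Finset.HasAntidiagonal.antidiagonal p.1, a r.1 * b r.2) * c p.2
        ∈ monomialSpan (t + 3) := by
  refine Submodule.sum_mem _ fun p hp => ?_
  have hp' := Finset.HasAntidiagonal.mem_antidiagonal.mp hp
  refine mul_mem_monomialSpan (u := p.1 + 2) (v := p.2 + 1) (by omega)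
    (Submodule.sum_mem _ fun r hr => ?_) (hc p.2)
  have hr' := Finset.HasAntidiagonal.mem_antidiagonal.mp hr
  exact mul_mem_monomialSpan (by omega) (ha r.1) (hb r.2)

/-! ### Reducible series: closure properties and linear building blocks -/

/-- The series `∑_{n ≥ 0} g n` converges, and its sum is reducible in weight `w`. -/
def ReducibleSum (w : ℕ) (g : ℕ → ℝ) : Prop := ∃ S ∈ reducibleToLinearSums w, HasSum g S

namespace ReducibleSum

variable {w : ℕ} {f g : ℕ → ℝ}

theorem congr (hf : ReducibleSum w f) (h : ∀ n, f n = g n) : ReducibleSum w g :=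
  funext h ▸ hf

theorem add (hf : ReducibleSum w f) (hg : ReducibleSum w g) :
    ReducibleSum w fun n => f n + g n := by
  obtain ⟨S, hS, hS'⟩ := hf
  obtain ⟨T, hT, hT'⟩ := hg
  exact ⟨S + T, Submodule.add_mem _ hS hT, hS'.add hT'⟩

theorem ratMul (r : ℚ) (hf : ReducibleSum w f) : ReducibleSum w fun n => (r : ℝ) * f n := by
  obtain ⟨S, hS, hS'⟩ := hf
  exact ⟨r * S, ratCast_mul_mem r hS, hS'.mul_left _⟩

theorem mul {u v : ℕ} (h : u + v = w) {x : ℝ} (hx : x ∈ monomialSpan u)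
    (hf : ReducibleSum v f) : ReducibleSum w fun n => x * f n := by
  obtain ⟨S, hS, hS'⟩ := hf
  exact ⟨x * S, mul_mem_reducibleToLinearSums h hx hS, hS'.mul_left _⟩

end ReducibleSum

/-- The source of all relations: the residue series sums to a combination of monomials alone, so a
quadratic series is reducible once the remaining terms of the residue are. -/
theorem reducibleSum_tripleResidue {a b c : ℤ → ℝ}
    {α β γ a₁ b₁ c₁ a₂ b₂ c₂ a₀ b₀ c₀ a' b' : ℕ → ℝ}
    (ha : KernelLimits a α a₁ a₂ a₀) (hb : KernelLimits b β b₁ b₂ b₀)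
    (hc : KernelLimits c γ c₁ c₂ c₀) (ha' : KernelOneSided a α a') (hb' : KernelOneSided b β b')
    (ha₀ : IsHomogeneous a₀) (hb₀ : IsHomogeneous b₀) (hc₀ : IsHomogeneous c₀)
    {t : ℕ} (ht : 1 ≤ t) :
    ReducibleSum (t + 3) fun n : ℕ =>
      tripleResidue (t + 1) ((n : ℝ) + 1) (a (n + 1)) (b (n + 1)) (c (n + 1))
        (a₁ n) (b₁ n) (c₁ n) (a₂ n) (b₂ n) (c₂ n)
        + c (-(n + 1)) * a' n * b' n / (-((n : ℝ) + 1)) ^ (t + 1) :=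
  ⟨_, monomialSpan_le _ (ha₀.sum_mem hb₀ hc₀ t), hasSum_tripleResidue ha hb hc ha' hb' ht⟩

theorem mem_reducibleToLinearSums_of_isLinearSum {w : ℕ} {s : ℝ} (hs : IsLinearSum w s) :
    s ∈ reducibleToLinearSums w :=
  Submodule.subset_span (Or.inr ⟨0, w, 1, s, zero_add w, IsZetaLogMonomial.one, hs,
    (one_mul s).symm⟩)

theorem summable_linear {τ : ℝ} (hτ : τ = 1 ∨ τ = -1) {X : ℕ → ℝ}
    (hX : ∀ n, |X n| ≤ genHarmonic 1 n) {q : ℕ} (hq : 2 ≤ q) :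
    Summable fun n : ℕ => τ ^ n * X (n + 1) / ((n : ℝ) + 1) ^ q := by
  refine Summable.of_norm_bounded summable_genHarmonic_sq_div_sq fun n => ?_
  have hx : (1 : ℝ) ≤ (n : ℝ) + 1 := by linarith [(Nat.cast_nonneg n : (0 : ℝ) ≤ n)]
  have h1 := hX (n + 1)
  have h2 := one_le_genHarmonic 1 n
  have h3 : |τ| = 1 := by rcases hτ with rfl | rfl <;> simp
  rw [Real.norm_eq_abs, abs_div, abs_mul, abs_pow, h3, one_pow, one_mul, abs_pow,
    abs_of_pos (by linarith : (0 : ℝ) < n + 1)]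
  exact div_le_div₀ (by positivity) (by nlinarith) (by positivity) (pow_le_pow_right₀ hx hq)

theorem abs_genHarmonic_le {p : ℕ} (hp : 1 ≤ p) (n : ℕ) :
    |genHarmonic p n| ≤ genHarmonic 1 n := by
  rw [abs_of_nonneg (genHarmonic_nonneg p n)]
  exact genHarmonic_le_one p n hp

theorem reducibleSum_genHarmonic_succ {τ : ℝ} (hτ : τ = 1 ∨ τ = -1) {p q : ℕ} (hp : 1 ≤ p)
    (hq : 2 ≤ q) :
    ReducibleSum (p + q) fun n => τ ^ n * genHarmonic p (n + 1) / ((n : ℝ) + 1) ^ q := by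
  refine ⟨_, mem_reducibleToLinearSums_of_isLinearSum ?_,
    (summable_linear hτ (abs_genHarmonic_le hp) hq).hasSum⟩
  rcases hτ with rfl | rfl
  · simpa using IsLinearSum.harm p q hp hq
  · exact IsLinearSum.harmAlt p q hp hq

theorem reducibleSum_altHarmonic_succ {τ : ℝ} (hτ : τ = 1 ∨ τ = -1) {p q : ℕ} (hp : 1 ≤ p)
    (hq : 2 ≤ q) :
    ReducibleSum (p + q) fun n => τ ^ n * altHarmonic p (n + 1) / ((n : ℝ) + 1) ^ q := by
  refine ⟨_, mem_reducibleToLinearSums_of_isLinearSum ?_, (summable_linear hτ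
    (fun n => (abs_altHarmonic_le p n).trans (genHarmonic_le_one p n hp)) hq).hasSum⟩
  rcases hτ with rfl | rfl
  · simpa using IsLinearSum.alt p q hp hq
  · exact IsLinearSum.altAlt p q hp hq

theorem reducibleSum_pow {τ : ℝ} (hτ : τ = 1 ∨ τ = -1) {q : ℕ} (hq : 2 ≤ q) :
    ReducibleSum q fun n => τ ^ n * (1 / ((n : ℝ) + 1) ^ q) := by
  have hs : Summable fun n : ℕ => 1 / ((n : ℝ) + 1) ^ q := by
    have := (summable_nat_add_iff 1).mpr (Real.summable_one_div_nat_pow.mpr (by omega : 1 < q))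
    simpa using this
  rcases hτ with rfl | rfl
  · refine ⟨_, monomialSpan_le _ (zetaValue_mem hq), ?_⟩
    simp only [one_pow, one_mul]
    exact hs.hasSum
  · have hs' : Summable fun n : ℕ => (-1) ^ n * (1 / ((n : ℝ) + 1) ^ q) := by
      refine Summable.of_norm_bounded hs fun n => ?_
      rw [Real.norm_eq_abs, abs_neg_one_pow_mul, abs_of_nonneg (by positivity)]
    refine ⟨_, monomialSpan_le _ (etaValue_mem (by omega : 1 ≤ q)), ?_⟩
    have h := hs'.hasSum.tendsto_sum_nat
    have h' : altHarmonic q =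
        fun n => ∑ j ∈ Finset.range n, (-1) ^ j * (1 / ((j : ℝ) + 1) ^ q) := by
      funext n
      exact Finset.sum_congr rfl fun j _ => (mul_one_div _ _).symm
    have h2 := tendsto_altHarmonic (by omega : 1 ≤ q)
    rw [h'] at h2
    rw [tendsto_nhds_unique h2 h]
    exact hs'.hasSum

/-- Residues involve the sums up to `n - 1`, linear sums those up to `n`; the difference is the
single term `1 / n^p`, which yields a zeta or eta value. -/
theorem reducibleSum_genHarmonic {τ : ℝ} (hτ : τ = 1 ∨ τ = -1) {p q w : ℕ} (hp : 1 ≤ p)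
    (hq : 2 ≤ q) (hw : p + q = w) :
    ReducibleSum w fun n => τ ^ n * genHarmonic p n / ((n : ℝ) + 1) ^ q := by
  subst hw
  refine ((reducibleSum_genHarmonic_succ hτ hp hq).add
    ((reducibleSum_pow hτ (q := p + q) (by omega)).ratMul (-1))).congr fun n => ?_
  rw [genHarmonic_succ]
  generalize (n : ℝ) + 1 = x
  push_cast
  ring

theorem reducibleSum_altHarmonic {τ : ℝ} (hτ : τ = 1 ∨ τ = -1) {p q w : ℕ} (hp : 1 ≤ p)
    (hq : 2 ≤ q) (hw : p + q = w) :
    ReducibleSum w fun n => τ ^ n * altHarmonic p n / ((n : ℝ) + 1) ^ q := by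
  subst hw
  have hτ' : τ * -1 = 1 ∨ τ * -1 = -1 := by rcases hτ with rfl | rfl <;> simp
  refine ((reducibleSum_altHarmonic_succ hτ hp hq).add
    ((reducibleSum_pow hτ' (q := p + q) (by omega)).ratMul (-1))).congr fun n => ?_
  rw [altHarmonic_succ, mul_pow]
  generalize (n : ℝ) + 1 = x
  push_cast
  ring

theorem harmWeight_succ (n : ℕ) : harmWeight (n + 1) = 1 := if_pos (by omega)

theorem harmWeight_neg (n : ℕ) : harmWeight (-(n + 1)) = 0 := if_neg (by omega)

theorem altWeight_succ (n : ℕ) : altWeight (n + 1) = -(-1) ^ n := by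
  have h : altWeight (n + 1) = (-1 : ℝ) ^ ((n : ℤ) + 1) := if_pos (by omega)
  rw [h, neg_one_zpow_succ, pow_succ]
  ring

theorem altWeight_neg (n : ℕ) : altWeight (-(n + 1)) = 0 := if_neg (by omega)

theorem neg_one_zpow_succ' (n : ℕ) : (-1 : ℝ) ^ ((n : ℤ) + 1) = -(-1) ^ n := by
  rw [neg_one_zpow_succ, pow_succ]
  ring

theorem neg_one_zpow_neg_succ (n : ℕ) : (-1 : ℝ) ^ (-((n : ℤ) + 1)) = -(-1) ^ n := by
  rw [isSignCharacter_neg_one_zpow.map_neg, neg_one_zpow_succ']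

theorem one_eq_one_or : (1 : ℝ) = 1 ∨ (1 : ℝ) = -1 := Or.inl rfl

theorem neg_one_eq_one_or : (-1 : ℝ) = 1 ∨ (-1 : ℝ) = -1 := Or.inr rfl

theorem log_two_sq_mem : Real.log 2 * Real.log 2 ∈ monomialSpan 2 :=
  mul_mem_monomialSpan one_add_one_eq_two log_two_mem log_two_mem

/-! ### The six quadratic sums, one kernel product each -/

/-- `∑ H_{n-1}² / n^q` from the cube of the digamma kernel. -/
theorem reducibleSum_harm_sq {t : ℕ} (ht : 1 ≤ t) :
    ReducibleSum (t + 3) fun n => genHarmonic 1 n ^ 2 / ((n : ℝ) + 1) ^ (t + 1) := by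
  -- Each of the three kernels can supply the pole, leaving `H²` from the others; hence the weight
  -- `1 / 3` below. There are no negative poles, so no parity condition.
  have G := reducibleSum_tripleResidue kernelLimits_harm kernelLimits_harm kernelLimits_harm
    kernelOneSided_harm kernelOneSided_harm isHomogeneous_harm isHomogeneous_harm
    isHomogeneous_harm ht
  have A1 := reducibleSum_genHarmonic one_eq_one_or (p := 2) (q := t + 1) (w := t + 3)
    (by omega) (by omega) (by omega)
  have A2 := (reducibleSum_pow one_eq_one_or (q := t + 1) (by omega)).mul (w := t + 3)
    (by omega) (zetaValue_mem le_rfl)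
  have A3 := reducibleSum_genHarmonic one_eq_one_or (p := 1) (q := t + 2) (w := t + 3)
    (by omega) (by omega) (by omega)
  have A4 := reducibleSum_pow one_eq_one_or (q := t + 3) (by omega)
  refine ((((G.ratMul (1 / 3)).add A1).add A2).add ((A3.ratMul (t + 1)).add
    (A4.ratMul (-((t + 1 + 1).choose 2 / 3))))).congr fun n => ?_
  simp only [harmWeight_succ, harmWeight_neg, tripleResidue, one_pow]
  generalize (n : ℝ) + 1 = x
  push_cast
  ring

/-- `∑ (-1)^(n-1) H_{n-1}² / n^q` for even `q`, from the square of the digamma kernel times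
the cosecant kernel. -/
theorem reducibleSum_alt_harm_sq {t : ℕ} (ht : 1 ≤ t) (hq : Even (t + 1)) :
    ReducibleSum (t + 3) fun n => (-1) ^ n * genHarmonic 1 n ^ 2 / ((n : ℝ) + 1) ^ (t + 1) := by
  -- The pole `n + 1` contributes `H_n²` and the pole `-(n + 1)` contributes `H_{n+1}²`, both with
  -- sign `-(-1)^n`. For even `q` they add, hence the weight `-1 / 2` below; for odd `q` the squares
  -- would cancel up to linear terms.
  have G := reducibleSum_tripleResidue kernelLimits_harm kernelLimits_harm kernelLimits_csc
    kernelOneSided_harm kernelOneSided_harm isHomogeneous_harm isHomogeneous_harm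
    isHomogeneous_csc ht
  have A1 := reducibleSum_genHarmonic one_eq_one_or (p := 1) (q := t + 2) (w := t + 3)
    (by omega) (by omega) (by omega)
  have A2 := (reducibleSum_pow neg_one_eq_one_or (q := t + 1) (by omega)).mul (w := t + 3)
    (by omega) (etaValue_mem one_le_two)
  have A3 := reducibleSum_pow one_eq_one_or (q := t + 3) (by omega)
  have A4 := reducibleSum_genHarmonic neg_one_eq_one_or (p := 2) (q := t + 1) (w := t + 3)
    (by omega) (by omega) (by omega)
  have A5 := (reducibleSum_pow neg_one_eq_one_or (q := t + 1) (by omega)).mul (w := t + 3)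
    (by omega) (zetaValue_mem le_rfl)
  have A6 := reducibleSum_genHarmonic neg_one_eq_one_or (p := 1) (q := t + 2) (w := t + 3)
    (by omega) (by omega) (by omega)
  have A7 := reducibleSum_pow neg_one_eq_one_or (q := t + 3) (by omega)
  refine ((((G.ratMul (-1 / 2)).add (A1.ratMul (-1))).add ((A2.ratMul (-1)).add
    (A3.ratMul ((1 + (t + 1)) / 2)))).add ((A4.add A5).add ((A6.ratMul t).add
    (A7.ratMul (-((1 + (t + 1 + 1).choose 2) / 2)))))).congr fun n => ?_
  simp only [harmWeight_succ, neg_one_zpow_succ', neg_one_zpow_neg_succ, tripleResidue, one_pow,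
    hq.neg_pow, genHarmonic_succ, pow_one, pow_succ (-1 : ℝ) n]
  generalize (n : ℝ) + 1 = x
  rcases neg_one_pow_eq_or ℝ n with h | h <;> rw [h] <;> push_cast <;> ring

/-- `∑ (-1)^(n-1) H_{n-1} L_{n-1} / n^q` for even `q`. -/
theorem reducibleSum_alt_harm_alt {t : ℕ} (ht : 1 ≤ t) (hq : Even (t + 1)) :
    ReducibleSum (t + 3) fun n =>
      (-1) ^ n * (genHarmonic 1 n * altHarmonic 1 n) / ((n : ℝ) + 1) ^ (t + 1) := by
  -- The quadratic part of the residue is `2 (-1)^n H (L - ln 2) - (-1)^n H²`; the last term is the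
  -- previous sum, which is where even `q` enters.
  have G := reducibleSum_tripleResidue kernelLimits_harm kernelLimits_harm kernelLimits_alt
    kernelOneSided_harm kernelOneSided_harm isHomogeneous_harm isHomogeneous_harm
    isHomogeneous_alt ht
  have A1 := (reducibleSum_genHarmonic neg_one_eq_one_or (p := 1) (q := t + 1) (w := t + 2)
    (by omega) (by omega) (by omega)).mul (w := t + 3) (by omega) log_two_mem
  have A2 := reducibleSum_alt_harm_sq ht hq
  have A3 := reducibleSum_altHarmonic neg_one_eq_one_or (p := 2) (q := t + 1) (w := t + 3)
    (by omega) (by omega) (by omega)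
  have A4 := (reducibleSum_pow neg_one_eq_one_or (q := t + 1) (by omega)).mul (w := t + 3)
    (by omega) (etaValue_mem one_le_two)
  have A5 := reducibleSum_genHarmonic neg_one_eq_one_or (p := 2) (q := t + 1) (w := t + 3)
    (by omega) (by omega) (by omega)
  have A6 := (reducibleSum_pow neg_one_eq_one_or (q := t + 1) (by omega)).mul (w := t + 3)
    (by omega) (zetaValue_mem le_rfl)
  have A7 := reducibleSum_altHarmonic neg_one_eq_one_or (p := 1) (q := t + 2) (w := t + 3)
    (by omega) (by omega) (by omega)
  have A8 := (reducibleSum_pow neg_one_eq_one_or (q := t + 2) (by omega)).mul (w := t + 3)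
    (by omega) log_two_mem
  have A9 := reducibleSum_genHarmonic neg_one_eq_one_or (p := 1) (q := t + 2) (w := t + 3)
    (by omega) (by omega) (by omega)
  have A10 := reducibleSum_pow neg_one_eq_one_or (q := t + 3) (by omega)
  refine (((((G.ratMul (1 / 2)).add A1).add ((A2.ratMul (1 / 2)).add
    ((A3.add A4).ratMul (1 / 2)))).add (((A5.add A6).ratMul (-1)).add
    ((A7.add (A8.ratMul (-1))).ratMul ((t + 1) / 2)))).add ((A9.ratMul (-(t + 1))).add
    (A10.ratMul ((t + 1 + 1).choose 2 / 2)))).congr fun n => ?_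
  simp only [harmWeight_succ, altWeight_succ, altWeight_neg, tripleResidue, pow_succ (-1 : ℝ) n]
  generalize (n : ℝ) + 1 = x
  rcases neg_one_pow_eq_or ℝ n with h | h <;> rw [h] <;> push_cast <;> ring

/-- `∑ (-1)^(n-1) L_{n-1}² / n^q` from the cube of the alternating digamma kernel. -/
theorem reducibleSum_alt_alt_sq {t : ℕ} (ht : 1 ≤ t) :
    ReducibleSum (t + 3) fun n => (-1) ^ n * altHarmonic 1 n ^ 2 / ((n : ℝ) + 1) ^ (t + 1) := by
  have G := reducibleSum_tripleResidue kernelLimits_alt kernelLimits_alt kernelLimits_alt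
    kernelOneSided_alt kernelOneSided_alt isHomogeneous_alt isHomogeneous_alt
    isHomogeneous_alt ht
  have A1 := (reducibleSum_altHarmonic neg_one_eq_one_or (p := 1) (q := t + 1) (w := t + 2)
    (by omega) (by omega) (by omega)).mul (w := t + 3) (by omega) log_two_mem
  have A2 := (reducibleSum_pow neg_one_eq_one_or (q := t + 1) (by omega)).mul (w := t + 3)
    (by omega) log_two_sq_mem
  have A3 := reducibleSum_altHarmonic neg_one_eq_one_or (p := 2) (q := t + 1) (w := t + 3)
    (by omega) (by omega) (by omega)
  have A4 := (reducibleSum_pow neg_one_eq_one_or (q := t + 1) (by omega)).mul (w := t + 3)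
    (by omega) (etaValue_mem one_le_two)
  have A5 := reducibleSum_altHarmonic neg_one_eq_one_or (p := 1) (q := t + 2) (w := t + 3)
    (by omega) (by omega) (by omega)
  have A6 := (reducibleSum_pow neg_one_eq_one_or (q := t + 2) (by omega)).mul (w := t + 3)
    (by omega) log_two_mem
  have A7 := reducibleSum_pow neg_one_eq_one_or (q := t + 3) (by omega)
  refine ((((G.ratMul (-1 / 3)).add (A1.ratMul 2)).add ((A2.add (A3.add A4)).ratMul (-1))).add
    (((A5.add (A6.ratMul (-1))).ratMul (-(t + 1))).add
    (A7.ratMul (-((t + 1 + 1).choose 2 / 3))))).congr fun n => ?_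
  simp only [altWeight_succ, altWeight_neg, tripleResidue, pow_succ (-1 : ℝ) n]
  generalize (n : ℝ) + 1 = x
  rcases neg_one_pow_eq_or ℝ n with h | h <;> rw [h] <;> push_cast <;> ring

/-- `∑ L_{n-1}² / n^q` for even `q`, from the square of the alternating digamma kernel times
the cotangent kernel. -/
theorem reducibleSum_alt_sq {t : ℕ} (ht : 1 ≤ t) (hq : Even (t + 1)) :
    ReducibleSum (t + 3) fun n => altHarmonic 1 n ^ 2 / ((n : ℝ) + 1) ^ (t + 1) := by
  -- The poles `n + 1` and `-(n + 1)` give `(L_n - ln 2)²` and `(L_{n+1} - ln 2)²`, which add for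
  -- even `q`. The cotangent kernel's own regular part is `1 / (n + 1)`, so the other terms are
  -- linear.
  have G := reducibleSum_tripleResidue kernelLimits_alt kernelLimits_alt kernelLimits_cot
    kernelOneSided_alt kernelOneSided_alt isHomogeneous_alt isHomogeneous_alt
    isHomogeneous_cot ht
  have A1 := (reducibleSum_altHarmonic one_eq_one_or (p := 1) (q := t + 1) (w := t + 2)
    (by omega) (by omega) (by omega)).mul (w := t + 3) (by omega) log_two_mem
  have A2 := (reducibleSum_pow one_eq_one_or (q := t + 1) (by omega)).mul (w := t + 3)
    (by omega) log_two_sq_mem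
  have A3 := reducibleSum_altHarmonic one_eq_one_or (p := 1) (q := t + 2) (w := t + 3)
    (by omega) (by omega) (by omega)
  have A4 := (reducibleSum_pow one_eq_one_or (q := t + 2) (by omega)).mul (w := t + 3)
    (by omega) log_two_mem
  have A5 := (reducibleSum_pow one_eq_one_or (q := t + 1) (by omega)).mul (w := t + 3)
    (by omega) (zetaValue_mem le_rfl)
  have A6 := reducibleSum_altHarmonic one_eq_one_or (p := 2) (q := t + 1) (w := t + 3)
    (by omega) (by omega) (by omega)
  have A7 := (reducibleSum_pow one_eq_one_or (q := t + 1) (by omega)).mul (w := t + 3)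
    (by omega) (etaValue_mem one_le_two)
  have A8 := reducibleSum_altHarmonic neg_one_eq_one_or (p := 1) (q := t + 2) (w := t + 3)
    (by omega) (by omega) (by omega)
  have A9 := (reducibleSum_pow neg_one_eq_one_or (q := t + 2) (by omega)).mul (w := t + 3)
    (by omega) log_two_mem
  have A10 := reducibleSum_pow one_eq_one_or (q := t + 3) (by omega)
  refine (((((G.ratMul (1 / 2)).add (A1.ratMul 2)).add (A2.ratMul (-1))).add
    (((A3.add (A4.ratMul (-1))).ratMul (-(1 + (t + 1)))).add A5)).add
    (((A6.add (A7.add A8)).ratMul (-1)).add (A9.add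
    (A10.ratMul (-((2 + (t + 1) + (t + 1 + 1).choose 2) / 2)))))).congr fun n => ?_
  simp only [altWeight_succ, tripleResidue, one_pow, hq.neg_pow, altHarmonic_succ, pow_one,
    pow_succ (-1 : ℝ) n]
  generalize (n : ℝ) + 1 = x
  rcases neg_one_pow_eq_or ℝ n with h | h <;> rw [h] <;> push_cast <;> ring

/-- `∑ H_{n-1} L_{n-1} / n^q` for even `q`. -/
theorem reducibleSum_harm_alt {t : ℕ} (ht : 1 ≤ t) (hq : Even (t + 1)) :
    ReducibleSum (t + 3) fun n =>
      genHarmonic 1 n * altHarmonic 1 n / ((n : ℝ) + 1) ^ (t + 1) := by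
  -- The quadratic part of the residue is `-2 H (L - ln 2) + (L - ln 2)²`; the square is removed by
  -- `reducibleSum_alt_sq`.
  have G := reducibleSum_tripleResidue kernelLimits_alt kernelLimits_alt kernelLimits_harm
    kernelOneSided_alt kernelOneSided_alt isHomogeneous_alt isHomogeneous_alt
    isHomogeneous_harm ht
  have A1 := (reducibleSum_genHarmonic one_eq_one_or (p := 1) (q := t + 1) (w := t + 2)
    (by omega) (by omega) (by omega)).mul (w := t + 3) (by omega) log_two_mem
  have A2 := reducibleSum_alt_sq ht hq
  have A3 := (reducibleSum_altHarmonic one_eq_one_or (p := 1) (q := t + 1) (w := t + 2)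
    (by omega) (by omega) (by omega)).mul (w := t + 3) (by omega) log_two_mem
  have A4 := (reducibleSum_pow one_eq_one_or (q := t + 1) (by omega)).mul (w := t + 3)
    (by omega) log_two_sq_mem
  have A5 := reducibleSum_genHarmonic one_eq_one_or (p := 2) (q := t + 1) (w := t + 3)
    (by omega) (by omega) (by omega)
  have A6 := (reducibleSum_pow one_eq_one_or (q := t + 1) (by omega)).mul (w := t + 3)
    (by omega) (zetaValue_mem le_rfl)
  have A7 := reducibleSum_altHarmonic one_eq_one_or (p := 2) (q := t + 1) (w := t + 3)
    (by omega) (by omega) (by omega)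
  have A8 := (reducibleSum_pow one_eq_one_or (q := t + 1) (by omega)).mul (w := t + 3)
    (by omega) (etaValue_mem one_le_two)
  have A9 := reducibleSum_genHarmonic one_eq_one_or (p := 1) (q := t + 2) (w := t + 3)
    (by omega) (by omega) (by omega)
  have A10 := reducibleSum_altHarmonic one_eq_one_or (p := 1) (q := t + 2) (w := t + 3)
    (by omega) (by omega) (by omega)
  have A11 := (reducibleSum_pow one_eq_one_or (q := t + 2) (by omega)).mul (w := t + 3)
    (by omega) log_two_mem
  have A12 := reducibleSum_pow one_eq_one_or (q := t + 3) (by omega)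
  refine (((((G.ratMul (-1 / 2)).add A1).add ((A2.add A4).ratMul (1 / 2))).add
    ((A3.ratMul (-1)).add ((A5.add A6).ratMul (-1 / 2)))).add (((A7.add A8).add
    (A9.ratMul (-(t + 1) / 2))).add (((A10.add (A11.ratMul (-1))).ratMul (t + 1)).add
    (A12.ratMul ((t + 1 + 1).choose 2 / 2))))).congr fun n => ?_
  simp only [harmWeight_succ, harmWeight_neg, altWeight_succ, tripleResidue, one_pow,
    pow_succ (-1 : ℝ) n]
  generalize (n : ℝ) + 1 = x
  rcases neg_one_pow_eq_or ℝ n with h | h <;> rw [h] <;> push_cast <;> ring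

/-! ### From sums up to `n - 1` to sums up to `n`, and the main theorem -/

theorem neg_eq_one_or {τ : ℝ} (hτ : τ = 1 ∨ τ = -1) : τ * -1 = 1 ∨ τ * -1 = -1 := by
  rcases hτ with rfl | rfl <;> simp

theorem reducibleSum_harm_sq_succ {τ : ℝ} (hτ : τ = 1 ∨ τ = -1) {t : ℕ} (ht : 1 ≤ t)
    (h : ReducibleSum (t + 3) fun n => τ ^ n * genHarmonic 1 n ^ 2 / ((n : ℝ) + 1) ^ (t + 1)) :
    ReducibleSum (t + 3) fun n =>
      τ ^ n * genHarmonic 1 (n + 1) ^ 2 / ((n : ℝ) + 1) ^ (t + 1) := by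
  have A1 := reducibleSum_genHarmonic hτ (p := 1) (q := t + 2) (w := t + 3)
    (by omega) (by omega) (by omega)
  have A2 := reducibleSum_pow hτ (q := t + 3) (by omega)
  refine ((h.add (A1.ratMul 2)).add A2).congr fun n => ?_
  rw [genHarmonic_succ]
  generalize (n : ℝ) + 1 = x
  push_cast
  ring

theorem reducibleSum_harm_alt_succ {τ : ℝ} (hτ : τ = 1 ∨ τ = -1) {t : ℕ} (ht : 1 ≤ t)
    (h : ReducibleSum (t + 3) fun n =>
      τ ^ n * (genHarmonic 1 n * altHarmonic 1 n) / ((n : ℝ) + 1) ^ (t + 1)) :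
    ReducibleSum (t + 3) fun n =>
      τ ^ n * (genHarmonic 1 (n + 1) * altHarmonic 1 (n + 1)) / ((n : ℝ) + 1) ^ (t + 1) := by
  have A1 := reducibleSum_genHarmonic (neg_eq_one_or hτ) (p := 1) (q := t + 2) (w := t + 3)
    (by omega) (by omega) (by omega)
  have A2 := reducibleSum_altHarmonic hτ (p := 1) (q := t + 2) (w := t + 3)
    (by omega) (by omega) (by omega)
  have A3 := reducibleSum_pow (neg_eq_one_or hτ) (q := t + 3) (by omega)
  refine ((h.add A1).add (A2.add A3)).congr fun n => ?_
  rw [genHarmonic_succ, altHarmonic_succ, mul_pow]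
  generalize (n : ℝ) + 1 = x
  ring

theorem reducibleSum_alt_sq_succ {τ : ℝ} (hτ : τ = 1 ∨ τ = -1) {t : ℕ} (ht : 1 ≤ t)
    (h : ReducibleSum (t + 3) fun n => τ ^ n * altHarmonic 1 n ^ 2 / ((n : ℝ) + 1) ^ (t + 1)) :
    ReducibleSum (t + 3) fun n =>
      τ ^ n * altHarmonic 1 (n + 1) ^ 2 / ((n : ℝ) + 1) ^ (t + 1) := by
  have A1 := reducibleSum_altHarmonic (neg_eq_one_or hτ) (p := 1) (q := t + 2) (w := t + 3)
    (by omega) (by omega) (by omega)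
  have A2 := reducibleSum_pow hτ (q := t + 3) (by omega)
  refine ((h.add (A1.ratMul 2)).add A2).congr fun n => ?_
  rw [altHarmonic_succ, mul_pow]
  generalize (n : ℝ) + 1 = x
  rcases neg_one_pow_eq_or ℝ n with h | h <;> rw [h] <;> push_cast <;> ring

/-- In `H - L` the odd-indexed terms cancel and the even-indexed ones double to `2 / (2j) = 1 / j`.
-/
theorem genHarmonic_sub_altHarmonic (n : ℕ) :
    genHarmonic 1 (2 * n + 1) - altHarmonic 1 (2 * n + 1) = genHarmonic 1 n := by
  have h : (-1 : ℝ) ^ (2 * n) = 1 := by simp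
  rw [genHarmonic_succ, altHarmonic_succ, altHarmonic_two_mul, h]
  ring

/-- Restricting a series supported on even indices. -/
theorem ReducibleSum.of_even {w : ℕ} {f g : ℕ → ℝ} (hf : ReducibleSum w f)
    (hodd : ∀ n, f (2 * n + 1) = 0) (hzero : f 0 = 0) (hg : ∀ n, f (2 * (n + 1)) = g n) :
    ReducibleSum w g := by
  obtain ⟨S, hS, h⟩ := hf
  refine ⟨S, hS, ?_⟩
  have h1 : HasSum (f ∘ fun n => 2 * n) S := by
    refine (Function.Injective.hasSum_iff (fun a b hab => by simpa using hab) fun k hk => ?_).mpr h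
    rcases Nat.even_or_odd' k with ⟨n, rfl | rfl⟩
    · exact absurd ⟨n, rfl⟩ hk
    · exact hodd n
  have h2 := (hasSum_nat_add_iff' 1).mpr h1
  simp only [Function.comp_apply, Finset.sum_range_one, mul_zero, hzero, sub_zero, hg] at h2
  exact h2

theorem theorem3p5 (m : ℕ) (hm : 1 ≤ m) :
    SeriesReducible (2 * m + 2)
      (fun n => altHarmonic 1 n ^ 2 / (n : ℝ) ^ (2 * m) * (-1 : ℝ) ^ (n - 1)) ∧
    SeriesReducible (2 * m + 2)
      (fun n => (harmonic n : ℝ) * altHarmonic 1 n / (n : ℝ) ^ (2 * m)) ∧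
    SeriesReducible (2 * m + 2)
      (fun n => (harmonic n : ℝ) * altHarmonic 1 n / (n : ℝ) ^ (2 * m) * (-1 : ℝ) ^ (n - 1)) ∧
    SeriesReducible (2 * m + 2)
      (fun n => (harmonic n : ℝ) ^ 2 / (n : ℝ) ^ (2 * m)) ∧
    SeriesReducible (2 * m + 2)
      (fun n => (harmonic n : ℝ) ^ 2 / (n : ℝ) ^ (2 * m) * (-1 : ℝ) ^ (n - 1)) ∧
    SeriesReducible (2 * m + 2)
      (fun n => altHarmonic 1 n ^ 2 / (n : ℝ) ^ (2 * m)) ∧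
    SeriesReducible (2 * m + 2)
      (fun n => (harmonic n : ℝ) ^ 2 / (2 * (n : ℝ) + 1) ^ (2 * m)) := by
  -- The exponent is `q = 2m = t + 1`, and `t` is the order of the Taylor coefficient compared.
  obtain ⟨t, ht⟩ : ∃ t, 2 * m = t + 1 := ⟨2 * m - 1, by omega⟩
  have ht1 : 1 ≤ t := by omega
  have hq : Even (t + 1) := ⟨m, by omega⟩
  have alt_sq_alt := reducibleSum_alt_sq_succ neg_one_eq_one_or ht1 (reducibleSum_alt_alt_sq ht1)
  have harm_alt := reducibleSum_harm_alt_succ one_eq_one_or ht1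
    ((reducibleSum_harm_alt ht1 hq).congr fun n => by rw [one_pow, one_mul])
  have harm_alt_alt := reducibleSum_harm_alt_succ neg_one_eq_one_or ht1
    (reducibleSum_alt_harm_alt ht1 hq)
  have harm_sq := reducibleSum_harm_sq_succ one_eq_one_or ht1
    ((reducibleSum_harm_sq ht1).congr fun n => by rw [one_pow, one_mul])
  have harm_sq_alt := reducibleSum_harm_sq_succ neg_one_eq_one_or ht1
    (reducibleSum_alt_harm_sq ht1 hq)
  have alt_sq := reducibleSum_alt_sq_succ one_eq_one_or ht1
    ((reducibleSum_alt_sq ht1 hq).congr fun n => by rw [one_pow, one_mul])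
  simp only [← genHarmonic_one, ht]
  refine ⟨alt_sq_alt.congr fun n => ?_, harm_alt.congr fun n => ?_, harm_alt_alt.congr fun n => ?_,
    harm_sq.congr fun n => ?_, harm_sq_alt.congr fun n => ?_, alt_sq.congr fun n => ?_, ?_⟩
  rotate_left 6
  -- Half the sum of the plain and alternating series of `(H - L)²` keeps exactly the odd summation
  -- indices, that is, even `n` here.
  · have hall := ((harm_sq.add alt_sq).add (harm_alt.ratMul (-2))).add
      ((harm_sq_alt.add alt_sq_alt).add (harm_alt_alt.ratMul (-2)))
    refine ReducibleSum.of_even ((hall.ratMul (1 / 2)).congr (g := fun n =>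
      (1 + (-1) ^ n) / 2 * (genHarmonic 1 (n + 1) - altHarmonic 1 (n + 1)) ^ 2 /
        ((n : ℝ) + 1) ^ (t + 1)) fun n => ?_) (fun n => ?_) ?_ fun n => ?_
    · generalize (n : ℝ) + 1 = x
      push_cast
      ring
    · simp [pow_succ]
    -- The summation index `1` contributes `H_1 - L_1 = 0`, so the series may start at `3 = 2 · 1 +
    -- 1`.
    · simp [genHarmonic, altHarmonic]
    · rw [genHarmonic_sub_altHarmonic]
      push_cast
      simp
  all_goals
    simp only [Nat.cast_add_one, Nat.add_sub_cancel, one_pow, one_mul]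
    try ring
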